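/- For a positive integer $k$ and an integer $h$ let $$s(h,k)=\sum_{a=1}^{k}\left(\left(\frac ak\right)\right)\left(\left(\frac{ah}{k}\right)\right),$$ where $((x))=x-\lfloor x\rfloor-\tfrac12$ if $x\notin\mathbb{Z}$ and $((x))=0$ if $x\in\mathbb{Z}$, be the Dedekind sum. Let $m\ge 1$ be a fixed integer. Then there is exactly one arithmetic function $f_m:\{1,2,3,\dots\}\to\mathbb{R}$ whose Dirichlet series converges absolutely for $\operatorname{Re} s>1$ and satisfies there $$\sum_{k=1}^{\infty}\frac{f_m(k)}{k^{s}}=2\,\frac{\zeta(2m)^2\,\zeta(s+4m-1)}{\zeta(4m)\,\zeta(s+2m)^2}\,\zeta(s),$$ and for this $f_m$, as $k\to\infty$ through the positive integers (not necessarily primes), $$\sum_{\substack{1\le h\le k\\ (h,k)=1}} s(h,k)^{2m}=f_m(k)\left(\frac{k}{12}\right)^{2m}+O\!\left(\left(k^{9/5}+k^{2m-1+\frac1{m+1}}\right)\log^3 k\right),$$ where the implied constant, and how large $k$ has to be, may depend on $m$. -/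

import Mathlib

open scoped Asymptotics
noncomputable section

/-- The sawtooth function `((x))`: it is `x - ⌊x⌋ - 1/2` if `x` is not an integer and `0` if
`x` is an integer. -/
def sawtooth (x : ℝ) : ℝ :=
  open scoped Classical in
  if ∃ n : ℤ, (n : ℝ) = x then 0 else x - (⌊x⌋ : ℝ) - 1 / 2

/-- The Dedekind sum `s(h, k) = ∑_{a=1}^k ((a/k)) ((ah/k))`, for an integer `h` and a positive
integer `k`. -/
def dedekindSum (h : ℤ) (k : ℕ) : ℝ :=
  ∑ a ∈ Finset.Icc 1 k, sawtooth ((a : ℝ) / (k : ℝ)) * sawtooth ((a : ℝ) * (h : ℝ) / (k : ℝ))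

/-- The Dirichlet series of the arithmetic function `f` converges absolutely in the half-plane
`Re s > 1`, with sum `2 ζ(2m)² ζ(s + 4m - 1) ζ(s) / (ζ(4m) ζ(s + 2m)²)`. -/
def HasMomentFactorSeries (m : ℕ) (f : ArithmeticFunction ℝ) : Prop :=
  ∀ s : ℂ, 1 < s.re →
    LSeriesHasSum (fun k : ℕ => ((f k : ℝ) : ℂ)) s
      (2 * (riemannZeta (2 * (m : ℂ)) ^ 2 * riemannZeta (s + 4 * (m : ℂ) - 1)) /
          (riemannZeta (4 * (m : ℂ)) * riemannZeta (s + 2 * (m : ℂ)) ^ 2) *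
        riemannZeta s)

end

/-!
If `r = q h - a k` and `q |r|` is small compared with `√k`, then descending with the reciprocity
law from `h / k` to `a / q` gives `12 s(h, k) = k / (q r) + O(q |r|)`. If there is no such pair
`(q, r)`, then the Euclidean algorithm for `h / k` has only small partial quotients, and `s(h, k)`
is small. Two pairs that are not proportional satisfy `k ≤ 2 (q |r|) (q' |r'|)`, so in the sum of
`(k / (q |r|)) ^ σ` over all `(q, r)` with `h q ≡ r` modulo `k`, the multiples `(g q, g r)` of one
pair dominate and contribute the factor `ζ(2 σ)`. Hence in both cases
`|12 s(h, k)| ^ σ ≈ k ^ σ / ζ(2 σ) * ∑ (q |r|) ^ (-σ)`. When this is summed over `h`, the right side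
can be evaluated by counting the solutions `h` of the congruence, and it yields a Dirichlet
convolution of powers and Möbius functions, whose Dirichlet series is a product of zeta functions.
-/

theorem sawtooth_of_fract_eq_zero {x : ℝ} (hx : Int.fract x = 0) : sawtooth x = 0 :=
  if_pos (Int.fract_eq_zero_iff.mp hx)

theorem sawtooth_of_fract_ne_zero {x : ℝ} (hx : Int.fract x ≠ 0) :
    sawtooth x = Int.fract x - 1 / 2 :=
  if_neg (Int.fract_eq_zero_iff.not.mp hx)

theorem sawtooth_add_intCast (x : ℝ) (n : ℤ) : sawtooth (x + n) = sawtooth x := by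
  by_cases hx : Int.fract x = 0
  · rw [sawtooth_of_fract_eq_zero hx,
      sawtooth_of_fract_eq_zero ((Int.fract_add_intCast x n).trans hx)]
  · rw [sawtooth_of_fract_ne_zero hx, sawtooth_of_fract_ne_zero, Int.fract_add_intCast]
    rwa [Int.fract_add_intCast]

theorem sawtooth_neg (x : ℝ) : sawtooth (-x) = -sawtooth x := by
  by_cases hx : Int.fract x = 0
  · rw [sawtooth_of_fract_eq_zero hx, sawtooth_of_fract_eq_zero (Int.fract_neg_eq_zero.mpr hx),
      neg_zero]
  · rw [sawtooth_of_fract_ne_zero hx, sawtooth_of_fract_ne_zero (Int.fract_neg_eq_zero.not.mpr hx),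
      Int.fract_neg hx]
    ring

theorem abs_sawtooth_le (x : ℝ) : |sawtooth x| ≤ 1 / 2 := by
  by_cases hx : Int.fract x = 0
  · norm_num [sawtooth_of_fract_eq_zero hx]
  · rw [sawtooth_of_fract_ne_zero hx, abs_le]
    constructor <;> linarith [Int.fract_nonneg x, Int.fract_lt_one x]

theorem sawtooth_natCast_div {n k : ℕ} (hk : 0 < k) (h : ¬k ∣ n) :
    sawtooth (n / k) = ((n % k : ℕ) : ℝ) / k - 1 / 2 := by
  rw [sawtooth_of_fract_ne_zero, Int.fract_div_natCast_eq_div_natCast_mod]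
  rw [Int.fract_div_natCast_eq_div_natCast_mod]
  have : n % k ≠ 0 := fun h0 => h (Nat.dvd_of_mod_eq_zero h0)
  positivity

theorem dedekindSum_add_mul (h n : ℤ) (k : ℕ) :
    dedekindSum (h + n * k) k = dedekindSum h k := by
  rcases k.eq_zero_or_pos with rfl | hk
  · simp only [Nat.cast_zero, mul_zero, add_zero]
  refine Finset.sum_congr rfl fun a _ => ?_
  have hshift : (a : ℝ) * ((h + n * k : ℤ) : ℝ) / k = a * h / k + ((a * n : ℤ) : ℝ) := by
    push_cast
    field_simp
  rw [hshift, sawtooth_add_intCast]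

theorem dedekindSum_neg (h : ℤ) (k : ℕ) : dedekindSum (-h) k = -dedekindSum h k := by
  simp only [dedekindSum, Int.cast_neg, mul_neg, neg_div, sawtooth_neg, Finset.sum_neg_distrib]

theorem dedekindSum_zero_left (k : ℕ) : dedekindSum 0 k = 0 := by
  simp [dedekindSum, sawtooth_of_fract_eq_zero]

theorem dedekindSum_one_right (h : ℤ) : dedekindSum h 1 = 0 := by
  simp [dedekindSum, sawtooth_of_fract_eq_zero]

theorem abs_dedekindSum_le (h : ℤ) (k : ℕ) : |dedekindSum h k| ≤ k / 4 := by
  have hterm (a : ℕ) :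
      |sawtooth ((a : ℝ) / k) * sawtooth ((a : ℝ) * h / k)| ≤ 1 / 2 * (1 / 2) := by
    rw [abs_mul]
    gcongr <;> exact abs_sawtooth_le _
  calc |dedekindSum h k|
      ≤ ∑ a ∈ Finset.Icc 1 k, |sawtooth ((a : ℝ) / k) * sawtooth ((a : ℝ) * h / k)| :=
        Finset.abs_sum_le_sum_abs _ _
    _ ≤ (Finset.Icc 1 k).card • (1 / 2 * (1 / 2) : ℝ) :=
        Finset.sum_le_card_nsmul _ _ _ fun a _ => hterm a
    _ = k / 4 := by
        rw [Nat.card_Icc, nsmul_eq_mul, Nat.add_sub_cancel]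
        ring

/-! ### The reciprocity law -/

theorem sum_range_natCast (k : ℕ) : ∑ a ∈ Finset.range k, (a : ℝ) = k * (k - 1) / 2 := by
  induction k with
  | zero => simp
  | succ n ih => rw [Finset.sum_range_succ, ih]; push_cast; ring

theorem sum_range_natCast_sq (k : ℕ) :
    ∑ a ∈ Finset.range k, (a : ℝ) ^ 2 = k * (k - 1) * (2 * k - 1) / 6 := by
  induction k with
  | zero => simp
  | succ n ih => rw [Finset.sum_range_succ, ih]; push_cast; ring

theorem sum_range_two_mul_sub_one (n : ℕ) :
    ∑ b ∈ Finset.range (n + 1), (2 * (b : ℝ) - 1) = n ^ 2 - 1 := by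
  rw [Finset.sum_sub_distrib, ← Finset.mul_sum, sum_range_natCast]
  simp only [Finset.sum_const, Finset.card_range, nsmul_eq_mul]
  push_cast
  ring

theorem natCast_mod_eq_sub (n k : ℕ) : ((n % k : ℕ) : ℝ) = n - k * ((n / k : ℕ) : ℝ) := by
  rw [eq_sub_iff_add_eq]
  exact_mod_cast Nat.mod_add_div n k

theorem sum_Icc_one_eq_sum_range {k : ℕ} {g : ℕ → ℝ} (hg : g 0 = g k) :
    ∑ a ∈ Finset.Icc 1 k, g a = ∑ a ∈ Finset.range k, g a := by
  have hshift : ∑ a ∈ Finset.Icc 1 k, g a = ∑ a ∈ Finset.range k, g (a + 1) := by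
    rw [← Finset.Ico_add_one_right_eq_Icc, Finset.sum_Ico_eq_sum_range]
    simp only [Nat.add_sub_cancel, add_comm]
  rw [hshift, ← add_left_inj (g 0), ← Finset.sum_range_succ', Finset.sum_range_succ, hg]

theorem sum_range_mul_mod {M : Type*} [AddCommMonoid M] {h k : ℕ} (hk : 0 < k)
    (hc : Nat.Coprime h k) (F : ℕ → M) :
    ∑ a ∈ Finset.range k, F (a * h % k) = ∑ a ∈ Finset.range k, F a := by
  have hmaps : Set.MapsTo (fun a => a * h % k) (Finset.range k) (Finset.range k) :=
    fun a _ => Finset.mem_coe.mpr (Finset.mem_range.mpr (Nat.mod_lt _ hk))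
  have hinj : Set.InjOn (fun a => a * h % k) (Finset.range k) := fun a ha b hb hab =>
    (Nat.ModEq.cancel_right_of_coprime hc.symm hab).eq_of_lt_of_lt (Finset.mem_range.mp ha)
      (Finset.mem_range.mp hb)
  exact Finset.sum_nbij _ hmaps hinj
    (Finset.surjOn_of_injOn_of_card_le _ hmaps hinj le_rfl) fun _ _ => rfl

theorem dedekindSum_eq_sum_range {h k : ℕ} (hk : 0 < k) (hc : Nat.Coprime h k) :
    dedekindSum h k = ∑ a ∈ Finset.range k,
      ((a : ℝ) / k - 1 / 2) * (((a * h % k : ℕ) : ℝ) / k - 1 / 2) - 1 / 4 := by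
  have hk' : (k : ℝ) ≠ 0 := by positivity
  have hzero : sawtooth 0 = 0 := sawtooth_of_fract_eq_zero Int.fract_zero
  have hone : sawtooth 1 = 0 := sawtooth_of_fract_eq_zero Int.fract_one
  have hterm : ∀ a ∈ Finset.range k, sawtooth ((a : ℝ) / k) * sawtooth ((a : ℝ) * (h : ℤ) / k) =
      ((a : ℝ) / k - 1 / 2) * (((a * h % k : ℕ) : ℝ) / k - 1 / 2) -
        if a = 0 then 1 / 4 else 0 := by
    intro a ha
    rcases a.eq_zero_or_pos with rfl | ha0
    · norm_num [hzero]
    · have hak : ¬k ∣ a := Nat.not_dvd_of_pos_of_lt ha0 (Finset.mem_range.mp ha)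
      have hahk : ¬k ∣ a * h := fun hd => hak (hc.symm.dvd_of_dvd_mul_right hd)
      rw [sawtooth_natCast_div hk hak, Int.cast_natCast, ← Nat.cast_mul,
        sawtooth_natCast_div hk hahk, Nat.mod_eq_of_lt (Finset.mem_range.mp ha), if_neg ha0.ne',
        sub_zero]
  rw [dedekindSum, sum_Icc_one_eq_sum_range (by simp [hzero, hone, hk']),
    Finset.sum_congr rfl hterm, Finset.sum_sub_distrib, Finset.sum_ite_eq',
    if_pos (Finset.mem_range.mpr hk)]

/-- The weighted sum `∑ a ⌊ah/k⌋` over `0 ≤ a < k`, in terms of which the Dedekind sum is a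
polynomial in `h`, `k` and `1/k`. -/
noncomputable def weightedFloorSum (h k : ℕ) : ℝ :=
  ∑ a ∈ Finset.range k, (a : ℝ) * ((a * h / k : ℕ) : ℝ)

theorem dedekindSum_eq_weightedFloorSum {h k : ℕ} (hk : 0 < k) (hc : Nat.Coprime h k) :
    dedekindSum h k = h * (k - 1) * (2 * k - 1) / (6 * k) - weightedFloorSum h k / k
      - (k - 1) / 4 := by
  have hterm (a : ℕ) : ((a : ℝ) / k - 1 / 2) * (((a * h % k : ℕ) : ℝ) / k - 1 / 2) =
      h / k ^ 2 * (a : ℝ) ^ 2 - 1 / k * (a * ((a * h / k : ℕ) : ℝ)) - 1 / (2 * k) * a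
        - 1 / (2 * k) * ((a * h % k : ℕ) : ℝ) + 1 / 4 := by
    rw [natCast_mod_eq_sub]
    push_cast
    field_simp
    ring
  rw [dedekindSum_eq_sum_range hk hc]
  simp only [hterm, Finset.sum_add_distrib, Finset.sum_sub_distrib, ← Finset.mul_sum]
  rw [sum_range_mul_mod hk hc (fun x => (x : ℝ)), sum_range_natCast, sum_range_natCast_sq,
    ← weightedFloorSum]
  simp only [Finset.sum_const, Finset.card_range, nsmul_eq_mul]
  field_simp
  ring

theorem sum_range_div {h k : ℕ} (hk : 0 < k) (hc : Nat.Coprime h k) :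
    ∑ a ∈ Finset.range k, ((a * h / k : ℕ) : ℝ) = (h - 1) * (k - 1) / 2 := by
  have hmod := sum_range_mul_mod hk hc (fun x => (x : ℝ))
  simp only [natCast_mod_eq_sub, Nat.cast_mul, Finset.sum_sub_distrib, ← Finset.mul_sum,
    ← Finset.sum_mul, sum_range_natCast] at hmod
  apply mul_left_cancel₀ (show (k : ℝ) ≠ 0 by positivity)
  linarith

theorem sum_range_div_sq_eq_weightedFloorSum {h k : ℕ} (hk : 0 < k) (hc : Nat.Coprime h k) :
    (k : ℝ) ^ 2 * ∑ a ∈ Finset.range k, ((a * h / k : ℕ) : ℝ) ^ 2 =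
      2 * h * k * weightedFloorSum h k + (1 - h ^ 2) * (k * (k - 1) * (2 * k - 1) / 6) := by
  have hterm (a : ℕ) : ((a * h % k : ℕ) : ℝ) ^ 2 = (h : ℝ) ^ 2 * (a : ℝ) ^ 2 -
      2 * h * k * (a * ((a * h / k : ℕ) : ℝ)) + (k : ℝ) ^ 2 * ((a * h / k : ℕ) : ℝ) ^ 2 := by
    rw [natCast_mod_eq_sub]
    push_cast
    ring
  have hmod := sum_range_mul_mod hk hc (fun x => (x : ℝ) ^ 2)
  simp only [hterm, Finset.sum_add_distrib, Finset.sum_sub_distrib, ← Finset.mul_sum,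
    sum_range_natCast_sq] at hmod
  rw [← weightedFloorSum] at hmod
  linarith

theorem natCast_div_sq_eq_sum_filter {a h k : ℕ} (hk : 0 < k) (hh : 0 < h) (ha : a < k) :
    ((a * h / k : ℕ) : ℝ) ^ 2 =
      1 + ∑ b ∈ Finset.range h with b * k ≤ a * h, (2 * (b : ℝ) - 1) := by
  have hfilter : (Finset.range h).filter (fun b => b * k ≤ a * h) =
      Finset.range (a * h / k + 1) := by
    ext b
    rw [Finset.mem_filter, Finset.mem_range, Finset.mem_range, Nat.lt_succ_iff,
      Nat.le_div_iff_mul_le hk, and_iff_right_iff_imp]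
    intro hb
    have : a * h < k * h := Nat.mul_lt_mul_of_pos_right ha hh
    exact Nat.lt_of_mul_lt_mul_right ((hb.trans_lt this).trans_eq (mul_comm k h))
  rw [hfilter, sum_range_two_mul_sub_one]
  ring

theorem card_filter_mul_le_mul {b h k : ℕ} (hh : 0 < h) (hc : Nat.Coprime h k) (hb : b < h) :
    (((Finset.range k).filter fun a => b * k ≤ a * h).card : ℝ) =
      k - 1 - ((b * k / h : ℕ) : ℝ) + if b = 0 then 1 else 0 := by
  rcases b.eq_zero_or_pos with rfl | hb0
  · simp
  have hdvd : ¬h ∣ b * k := fun hd =>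
    Nat.not_dvd_of_pos_of_lt hb0 hb (hc.dvd_of_dvd_mul_right hd)
  have hfilter : (Finset.range k).filter (fun a => b * k ≤ a * h) =
      Finset.Ico (b * k / h + 1) k := by
    ext a
    have hne : b * k ≠ a * h := fun he => hdvd ⟨a, he.trans (mul_comm a h)⟩
    rw [Finset.mem_filter, Finset.mem_range, Finset.mem_Ico, Nat.succ_le_iff,
      Nat.div_lt_iff_lt_mul hh, hne.le_iff_lt, and_comm]
  have hk : 0 < k := Nat.pos_of_ne_zero fun h0 => hdvd (by simp [h0])
  have hlt : b * k / h < k := (Nat.div_lt_iff_lt_mul hh).mpr (by nlinarith)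
  rw [hfilter, Nat.card_Ico, Nat.cast_sub hlt, if_neg hb0.ne']
  push_cast
  ring

/- Double counting of the lattice points `(a, b)` with `b k ≤ a h`, weighted by `2 b - 1`. -/
theorem sum_range_div_sq {h k : ℕ} (hh : 0 < h) (hk : 0 < k) (hc : Nat.Coprime h k) :
    ∑ a ∈ Finset.range k, ((a * h / k : ℕ) : ℝ) ^ 2 =
      (k - 1) * (h - 1) ^ 2 + (h - 1) * (k - 1) / 2 - 2 * weightedFloorSum k h := by
  have hcount : ∀ b ∈ Finset.range h, ∑ a ∈ Finset.range k with b * k ≤ a * h, (2 * (b : ℝ) - 1) =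
      2 * (k - 1) * b - (k - 1) - 2 * (b * ((b * k / h : ℕ) : ℝ)) + ((b * k / h : ℕ) : ℝ) -
        if b = 0 then 1 else 0 := by
    intro b hb
    rw [Finset.sum_const, nsmul_eq_mul, card_filter_mul_le_mul hh hc (Finset.mem_range.mp hb)]
    split_ifs with hb0
    · rw [hb0]
      ring
    · ring
  rw [Finset.sum_congr rfl fun a ha =>
      natCast_div_sq_eq_sum_filter hk hh (Finset.mem_range.mp ha),
    Finset.sum_add_distrib, Finset.sum_comm' (t' := Finset.range h)
      (s' := fun b => (Finset.range k).filter fun a => b * k ≤ a * h) (by simp; tauto),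
    Finset.sum_congr rfl hcount]
  simp only [Finset.sum_add_distrib, Finset.sum_sub_distrib, ← Finset.mul_sum,
    sum_range_div hh hc.symm, sum_range_natCast, Finset.sum_const, Finset.card_range, nsmul_eq_mul,
    Finset.sum_ite_eq', Finset.mem_range, hh, if_true]
  rw [← weightedFloorSum]
  ring

theorem dedekindSum_reciprocity {h k : ℕ} (hh : 0 < h) (hk : 0 < k) (hc : Nat.Coprime h k) :
    12 * dedekindSum h k + 12 * dedekindSum k h = (h : ℝ) / k + k / h + 1 / (h * k) - 3 := by
  have hfloor := sum_range_div_sq_eq_weightedFloorSum hk hc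
  rw [sum_range_div_sq hh hk hc] at hfloor
  have hW : weightedFloorSum h k = (k ^ 2 * ((k - 1) * (h - 1) ^ 2 + (h - 1) * (k - 1) / 2
      - 2 * weightedFloorSum k h) - (1 - h ^ 2) * (k * (k - 1) * (2 * k - 1) / 6)) /
        (2 * h * k) := by
    rw [eq_div_iff (by positivity)]
    linarith
  rw [dedekindSum_eq_weightedFloorSum hk hc, dedekindSum_eq_weightedFloorSum hh hc.symm, hW]
  field_simp
  ring

/-! ### The three-term relation -/

/-- The error in the approximation `12 s(h, k) - 12 s(a, q) ≈ (k² + q² + r²) / (k q r)`, where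
`r = q h - a k`. It is invariant under the simultaneous action of the modular group on `h / k`
and `a / q`, which makes it easy to bound. -/
noncomputable def threeTermDefect (h : ℤ) (k : ℕ) (a : ℤ) (q : ℕ) : ℝ :=
  12 * dedekindSum h k - 12 * dedekindSum a q -
    ((k : ℝ) ^ 2 + q ^ 2 + (q * h - a * k) ^ 2) / (k * q * (q * h - a * k))

theorem threeTermDefect_add_mul (h a t : ℤ) (k q : ℕ) :
    threeTermDefect (h + t * k) k (a + t * q) q = threeTermDefect h k a q := by
  have hdet : (q : ℝ) * (h + t * k : ℤ) - (a + t * q : ℤ) * k = q * h - a * k := by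
    push_cast
    ring
  simp only [threeTermDefect, dedekindSum_add_mul, hdet]

theorem threeTermDefect_neg (h a : ℤ) (k q : ℕ) :
    threeTermDefect (-h) k (-a) q = -threeTermDefect h k a q := by
  have hdet : (q : ℝ) * (-h : ℤ) - (-a : ℤ) * k = -(q * h - a * k) := by
    push_cast
    ring
  simp only [threeTermDefect, dedekindSum_neg, hdet, neg_sq, mul_neg, div_neg]
  ring

theorem threeTermDefect_neg_inv {h k a q : ℕ} (hh : 0 < h) (hk : 0 < k) (ha : 0 < a) (hq : 0 < q)
    (hhk : Nat.Coprime h k) (haq : Nat.Coprime a q) (hr : (q : ℤ) * h - a * k ≠ 0) :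
    threeTermDefect (-k) h (-q) a = threeTermDefect h k a q := by
  have hrec_h := dedekindSum_reciprocity hh hk hhk
  have hrec_a := dedekindSum_reciprocity ha hq haq
  have hr' : (q : ℝ) * h - a * k ≠ 0 := by exact_mod_cast hr
  have hdet : (a : ℝ) * (-k : ℤ) - (-q : ℤ) * h = q * h - a * k := by
    push_cast
    ring
  have hid : (h : ℝ) / k + k / h + 1 / (h * k) - (a / q + q / a + 1 / (a * q)) =
      ((k : ℝ) ^ 2 + q ^ 2 + (q * h - a * k) ^ 2) / (k * q * (q * h - a * k)) -
        ((h : ℝ) ^ 2 + a ^ 2 + (q * h - a * k) ^ 2) / (h * a * (q * h - a * k)) := by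
    generalize hR : (q * h - a * k : ℝ) = r at hr' ⊢
    field_simp
    rw [← hR]
    ring
  simp only [threeTermDefect, dedekindSum_neg, hdet, Int.cast_natCast]
  linarith

theorem abs_threeTermDefect_zero_one_le {h k : ℕ} (hh : 0 < h) (hk : 0 < k)
    (hhk : Nat.Coprime h k) : |threeTermDefect h k 0 1| ≤ 3 * h + 3 := by
  have hdefect : threeTermDefect h k 0 1 = -(12 * dedekindSum k h) - 3 := by
    have hrec := dedekindSum_reciprocity hh hk hhk
    have hfrac : ((k : ℝ) ^ 2 + 1 + h ^ 2) / (k * h) = h / k + k / h + 1 / (h * k) := by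
      field_simp
      ring
    simp only [threeTermDefect, dedekindSum_one_right, Int.cast_natCast, Int.cast_zero,
      Nat.cast_one, one_mul, mul_one, zero_mul, sub_zero, one_pow, mul_zero, hfrac]
    linarith
  have hle := abs_le.mp (abs_dedekindSum_le k h)
  rw [hdefect, abs_le]
  constructor <;> linarith [hle.1, hle.2]

theorem abs_threeTermDefect_le_of_pos {q : ℕ} (hq : 0 < q) {k : ℕ} (hk : 0 < k) {h a : ℤ}
    (hhk : IsCoprime h k) (haq : IsCoprime a q) (hr : 0 < q * h - a * k) :
    |threeTermDefect h k a q| ≤ 3 * (q * h - a * k) + 3 := by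
  induction q using Nat.strong_induction_on generalizing k h a with
  | _ q ih =>
  wlog ha : 0 ≤ a ∧ a < q generalizing h a
  · have ha' : a + -(a / q) * q = a % q := by
      rw [Int.emod_def]
      ring
    have key := this (h := h + -(a / q) * k) (a := a + -(a / q) * q)
      (IsCoprime.add_mul_right_left_iff.mpr hhk) (IsCoprime.add_mul_right_left_iff.mpr haq)
      (by linarith) ⟨ha' ▸ Int.emod_nonneg a (by lia), ha' ▸ Int.emod_lt_of_pos a (by lia)⟩
    rw [threeTermDefect_add_mul] at key
    push_cast at key
    linarith
  obtain ⟨ha0, haq_lt⟩ := ha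
  have hh : 0 < h := by
    have : 0 < q * h := by linarith [mul_nonneg ha0 (Int.natCast_nonneg k)]
    exact pos_of_mul_pos_right this (by positivity)
  lift h to ℕ using hh.le
  lift a to ℕ using ha0
  rw [Nat.isCoprime_iff_coprime] at hhk haq
  norm_cast at hh haq_lt
  rcases a.eq_zero_or_pos with rfl | ha
  · obtain rfl : q = 1 := (Nat.coprime_zero_left q).mp haq
    simpa using abs_threeTermDefect_zero_one_le hh hk hhk
  · have key := ih a haq_lt ha hh (h := -k) (a := -q)
      (Nat.isCoprime_iff_coprime.mpr hhk.symm).neg_left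
      (Nat.isCoprime_iff_coprime.mpr haq.symm).neg_left (by linarith)
    rw [threeTermDefect_neg_inv hh hk ha hq hhk haq hr.ne'] at key
    push_cast at key ⊢
    linarith

theorem abs_threeTermDefect_le {k q : ℕ} {h a : ℤ} (hq : 0 < q) (hk : 0 < k)
    (hhk : IsCoprime h k) (haq : IsCoprime a q) (hr : q * h - a * k ≠ 0) :
    |threeTermDefect h k a q| ≤ 3 * |(q * h - a * k : ℝ)| + 3 := by
  rcases hr.lt_or_gt with hr | hr
  · have key := abs_threeTermDefect_le_of_pos hq hk hhk.neg_left haq.neg_left (by linarith)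
    have hr' : (q * h - a * k : ℝ) < 0 := by exact_mod_cast hr
    rw [threeTermDefect_neg, abs_neg] at key
    rw [abs_of_neg hr']
    push_cast at key
    linarith
  · have hr' : (0 : ℝ) < q * h - a * k := by exact_mod_cast hr
    rw [abs_of_pos hr']
    exact abs_threeTermDefect_le_of_pos hq hk hhk haq hr

theorem one_le_abs_intCast {r : ℤ} (hr : r ≠ 0) : (1 : ℝ) ≤ |(r : ℝ)| := by
  exact_mod_cast Int.one_le_abs hr

theorem abs_dedekindSum_sub_le {k q : ℕ} {h a r : ℤ} (hq : 0 < q) (hk : 0 < k) (hr : r ≠ 0)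
    (hhk : IsCoprime h k) (haq : IsCoprime a q) (hdet : q * h - a * k = r) :
    |12 * dedekindSum h k - k / (q * r)| ≤ 11 * (q * |(r : ℝ)|) := by
  have hk1 : (1 : ℝ) ≤ k := by exact_mod_cast hk
  have hq1 : (1 : ℝ) ≤ q := by exact_mod_cast hq
  have hr1 := one_le_abs_intCast hr
  have hr0 : (r : ℝ) ≠ 0 := by exact_mod_cast hr
  have hdetR : (q * h - a * k : ℝ) = r := by exact_mod_cast hdet
  have hdefect := abs_threeTermDefect_le hq hk hhk haq (hdet ▸ hr)
  have hsplit : 12 * dedekindSum h k - k / (q * r) =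
      threeTermDefect h k a q + 12 * dedekindSum a q + q / (k * r) + r / (k * q) := by
    rw [threeTermDefect, hdetR]
    field_simp
    ring
  have hsum : |12 * dedekindSum a q| ≤ 3 * q := by
    rw [abs_mul, abs_of_pos (by norm_num : (0 : ℝ) < 12)]
    linarith [abs_dedekindSum_le a q]
  have hq_div : |(q : ℝ) / (k * r)| ≤ q := by
    rw [abs_div, abs_mul, Nat.abs_cast, Nat.abs_cast]
    exact div_le_self (by positivity) (one_le_mul_of_one_le_of_one_le hk1 hr1)
  have hr_div : |(r : ℝ) / (k * q)| ≤ |(r : ℝ)| := by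
    rw [abs_div, abs_mul, Nat.abs_cast, Nat.abs_cast]
    exact div_le_self (abs_nonneg _) (one_le_mul_of_one_le_of_one_le hk1 hq1)
  rw [hdetR] at hdefect
  rw [hsplit]
  calc |threeTermDefect h k a q + 12 * dedekindSum a q + q / (k * r) + r / (k * q)|
      ≤ |threeTermDefect h k a q| + |12 * dedekindSum a q| + |(q : ℝ) / (k * r)|
          + |(r : ℝ) / (k * q)| := (abs_add_le _ _).trans
        (add_le_add_left ((abs_add_le _ _).trans (add_le_add_left (abs_add_le _ _) _)) _)
    _ ≤ 4 * (|(r : ℝ)| + q) + 3 := by linarith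
    _ ≤ 11 * (q * |(r : ℝ)|) := by nlinarith

/-! ### The lattice of a residue class -/

/-- The lattice of pairs `(q, r)` with `h q ≡ r` modulo `k`, restricted to `q ≥ 0`. A pair with
small product `q |r|` corresponds to a rational number with denominator `q` that approximates
`h / k` well. -/
def congruenceLattice (h : ℤ) (k : ℕ) : Set (ℕ × ℤ) := {p | (k : ℤ) ∣ h * p.1 - p.2}

theorem mem_congruenceLattice {h : ℤ} {k : ℕ} {p : ℕ × ℤ} :
    p ∈ congruenceLattice h k ↔ (k : ℤ) ∣ h * p.1 - p.2 := Iff.rfl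

/-- The height `q |r|` of a pair `(q, r)`. -/
noncomputable def pairHeight (p : ℕ × ℤ) : ℝ := p.1 * |(p.2 : ℝ)|

theorem pairHeight_nonneg (p : ℕ × ℤ) : 0 ≤ pairHeight p := by
  unfold pairHeight
  positivity

theorem pairHeight_ne_zero_iff {p : ℕ × ℤ} : pairHeight p ≠ 0 ↔ p.1 ≠ 0 ∧ p.2 ≠ 0 := by
  simp [pairHeight]

theorem one_le_pairHeight {p : ℕ × ℤ} (hp : pairHeight p ≠ 0) : 1 ≤ pairHeight p := by
  obtain ⟨hq, hr⟩ := pairHeight_ne_zero_iff.mp hp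
  exact one_le_mul_of_one_le_of_one_le (by exact_mod_cast Nat.one_le_iff_ne_zero.mpr hq)
    (one_le_abs_intCast hr)

/-! ### The Euclidean algorithm -/

theorem dedekindSum_natCast_mod (y x : ℕ) : dedekindSum (y % x : ℕ) x = dedekindSum y x := by
  have hdiv : ((y % x : ℕ) : ℤ) + (y / x : ℕ) * x = y := by exact_mod_cast Nat.mod_add_div' y x
  rw [← dedekindSum_add_mul _ (y / x : ℕ), hdiv]

theorem abs_dedekindSum_le_add_mod {x y : ℕ} (hx : 0 < x) (hxy : x ≤ y) (hc : Nat.Coprime x y) :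
    |12 * dedekindSum x y| ≤ y / x + 3 + |12 * dedekindSum (y % x : ℕ) x| := by
  have hx1 : (1 : ℝ) ≤ x := by exact_mod_cast hx
  have hxy' : (x : ℝ) ≤ y := by exact_mod_cast hxy
  have hrec := dedekindSum_reciprocity hx (hx.trans_le hxy) hc
  have hx_div : (x : ℝ) / y ≤ 1 := div_le_one_of_le₀ hxy' (by positivity)
  have hone_div : 1 / ((x : ℝ) * y) ≤ 1 :=
    div_le_one_of_le₀ (one_le_mul_of_one_le_of_one_le hx1 (hx1.trans hxy')) (by positivity)
  have hmain : |(x : ℝ) / y + y / x + 1 / (x * y) - 3| ≤ y / x + 3 := by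
    have hx_div0 : 0 ≤ (x : ℝ) / y := by positivity
    have hone_div0 : 0 ≤ 1 / ((x : ℝ) * y) := by positivity
    have hy_div0 : 0 ≤ (y : ℝ) / x := by positivity
    rw [abs_le]
    constructor <;> linarith
  rw [dedekindSum_natCast_mod, eq_sub_of_add_eq hrec]
  exact (abs_sub _ _).trans (add_le_add_left hmain _)

theorem add_mul_mem_congruenceLattice {h : ℤ} {k P Q : ℕ} {s t : ℤ}
    (hP : (P, s) ∈ congruenceLattice h k) (hQ : (Q, t) ∈ congruenceLattice h k) (c : ℕ) :
    (P + c * Q, s + c * t) ∈ congruenceLattice h k := by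
  have hcomb : (k : ℤ) ∣ (h * P - s) + c * (h * Q - t) := dvd_add hP (dvd_mul_of_dvd_right hQ _)
  rw [mem_congruenceLattice]
  convert hcomb using 1
  push_cast
  ring

theorem natCast_div_le_of_mem_congruenceLattice {h : ℤ} {k : ℕ} {M : ℝ}
    (hM : ∀ p ∈ congruenceLattice h k, pairHeight p ≠ 0 → k ≤ M * pairHeight p)
    {x y Q : ℕ} {ε : ℤ} (hε : |ε| = 1) (hx : 0 < x) (hQ : 0 < Q) (hyQ : y * Q ≤ k)
    (hQx : (Q, ε * x) ∈ congruenceLattice h k) : (y : ℝ) / x ≤ M := by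
  have hheight : pairHeight (Q, ε * x) = Q * x := by
    have hεR : |(ε : ℝ)| = 1 := by exact_mod_cast hε
    rw [pairHeight, Int.cast_mul, abs_mul, hεR, one_mul, Int.cast_natCast, Nat.abs_cast]
  have hyQ' : (y * Q : ℝ) ≤ k := by exact_mod_cast hyQ
  have hkM := hM _ hQx (by rw [hheight]; positivity)
  rw [hheight] at hkM
  rw [div_le_iff₀ (by positivity)]
  refine le_of_mul_le_mul_right ?_ (show (0 : ℝ) < Q by positivity)
  linarith

/- The Euclidean algorithm for `h / k` runs through pairs `(x, y)` of consecutive remainders.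
With the corresponding denominators `Q`, `P` of convergents, `(Q, ± x)` and `(P, ∓ y)` lie in the
lattice of `h / k`, so that each partial quotient `y / x` is at most `M`; each step at least
halves `x y`. -/
theorem abs_dedekindSum_le_of_mul_lt_two_pow {h : ℤ} {k : ℕ} {M : ℝ} (hM0 : 0 ≤ M)
    (hM : ∀ p ∈ congruenceLattice h k, pairHeight p ≠ 0 → k ≤ M * pairHeight p)
    {n x y P Q : ℕ} {ε : ℤ} (hε : |ε| = 1) (hxy : x ≤ y) (hc : Nat.Coprime x y) (hQ : 0 < Q)
    (hsum : y * Q + x * P = k) (hQx : (Q, ε * x) ∈ congruenceLattice h k)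
    (hPy : (P, -(ε * y)) ∈ congruenceLattice h k) (hn : x * y < 2 ^ n) :
    |12 * dedekindSum x y| ≤ (M + 3) * n := by
  induction n generalizing x y P Q ε with
  | zero =>
    obtain rfl : x = 0 := by nlinarith
    simp [dedekindSum_zero_left]
  | succ n ih =>
    rcases x.eq_zero_or_pos with rfl | hx
    · rw [Nat.cast_zero, dedekindSum_zero_left, mul_zero, abs_zero]
      positivity
    have hquot : 0 < y / x := Nat.div_pos hxy hx
    have hdiv : (y % x : ℕ) + y / x * x = y := Nat.mod_add_div' y x
    have hdivZ : ((y % x : ℕ) : ℤ) = y - (y / x : ℕ) * x := by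
      rw [eq_sub_iff_add_eq]
      exact_mod_cast hdiv
    have hratio : (y : ℝ) / x ≤ M :=
      natCast_div_le_of_mem_congruenceLattice hM hε hx hQ (hsum ▸ Nat.le_add_right _ _) hQx
    have hrec : |12 * dedekindSum (y % x : ℕ) x| ≤ (M + 3) * n := by
      refine ih (P := Q) (Q := P + y / x * Q) (ε := -ε) (by rwa [abs_neg])
        (Nat.mod_lt y hx).le ?_ (by positivity) ?_ ?_ ?_ ?_
      · rwa [Nat.Coprime, ← Nat.gcd_rec]
      · rw [← hsum]
        nth_rewrite 3 [← hdiv]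
        ring
      · rw [show -ε * ((y % x : ℕ) : ℤ) = -(ε * y) + (y / x : ℕ) * (ε * x) by rw [hdivZ]; ring]
        exact add_mul_mem_congruenceLattice hPy hQx _
      · simpa only [neg_mul, neg_neg] using hQx
      · have hhalf : 2 * (y % x) ≤ y := by
          have := Nat.mod_lt y hx
          nlinarith
        have := Nat.mul_le_mul_right x hhalf
        rw [pow_succ] at hn
        lia
    calc |12 * dedekindSum x y|
        ≤ y / x + 3 + |12 * dedekindSum (y % x : ℕ) x| := abs_dedekindSum_le_add_mod hx hxy hc
      _ ≤ M + 3 + (M + 3) * n := by gcongr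
      _ = (M + 3) * (n + 1 : ℕ) := by push_cast; ring

theorem natLog_two_mul_add_one_le {h k : ℕ} (hh : 0 < h) (hhk : h ≤ k) :
    ((Nat.log 2 (h * k) + 1 : ℕ) : ℝ) ≤ 3 * (1 + Real.log k) := by
  have hk0 : 0 < k := hh.trans_le hhk
  have hpow : (2 : ℝ) ^ Nat.log 2 (h * k) ≤ k ^ 2 := by
    have hlog := Nat.pow_log_le_self 2 (show h * k ≠ 0 by positivity)
    exact_mod_cast hlog.trans ((Nat.mul_le_mul_right k hhk).trans_eq (sq k).symm)
  have hlog := Real.log_le_log (by positivity) hpow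
  rw [Real.log_pow, Real.log_pow] at hlog
  have hlog0 : 0 ≤ Real.log k := Real.log_natCast_nonneg k
  push_cast at hlog ⊢
  nlinarith [Real.log_two_gt_d9, Nat.cast_nonneg (α := ℝ) (Nat.log 2 (h * k))]

theorem abs_dedekindSum_le_log {h k : ℕ} (hh : 0 < h) (hhk : h ≤ k) (hc : Nat.Coprime h k) {M : ℝ}
    (hM : ∀ p ∈ congruenceLattice h k, pairHeight p ≠ 0 → k ≤ M * pairHeight p) :
    |12 * dedekindSum h k| ≤ 12 * M * (1 + Real.log k) := by
  have hheight : pairHeight (1, (h : ℤ)) = h := by simp [pairHeight]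
  have hM1 : 1 ≤ M := by
    have hkM := hM (1, (h : ℤ)) (by simp [mem_congruenceLattice]) (by rw [hheight]; positivity)
    have hhk' : (h : ℝ) ≤ k := by exact_mod_cast hhk
    rw [hheight] at hkM
    refine le_of_mul_le_mul_right ?_ (show (0 : ℝ) < h by positivity)
    linarith
  have : 0 ≤ Real.log k := Real.log_natCast_nonneg k
  calc |12 * dedekindSum h k|
      ≤ (M + 3) * (Nat.log 2 (h * k) + 1 : ℕ) :=
        abs_dedekindSum_le_of_mul_lt_two_pow (h := h) (P := 0) (Q := 1) (ε := 1) (by linarith) hM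
          (by simp) hhk hc one_pos (by ring) (by simp [mem_congruenceLattice])
          (by simp [mem_congruenceLattice]) (Nat.lt_pow_succ_log_self one_lt_two _)
    _ ≤ (4 * M) * (3 * (1 + Real.log k)) := by
        gcongr
        · linarith
        · exact natLog_two_mul_add_one_le hh hhk
    _ = 12 * M * (1 + Real.log k) := by ring

/-! ### Real powers as arithmetic functions -/

/-- The arithmetic function `n ↦ n ^ e` with a real exponent (and the value `0` at `n = 0`). -/
noncomputable def rpowArith (e : ℝ) : ArithmeticFunction ℝ :=
  ⟨fun n => if n = 0 then 0 else (n : ℝ) ^ e, if_pos rfl⟩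

theorem rpowArith_apply {e : ℝ} {n : ℕ} (hn : n ≠ 0) : rpowArith e n = (n : ℝ) ^ e := if_neg hn

theorem mul_pmul_rpowArith (f g : ArithmeticFunction ℝ) (e : ℝ) :
    (f * g).pmul (rpowArith e) = f.pmul (rpowArith e) * g.pmul (rpowArith e) := by
  ext n
  rw [ArithmeticFunction.pmul_apply, ArithmeticFunction.mul_apply, ArithmeticFunction.mul_apply,
    Finset.sum_mul]
  refine Finset.sum_congr rfl fun x hx => ?_
  obtain ⟨rfl, hn⟩ := Nat.mem_divisorsAntidiagonal.mp hx
  rw [ArithmeticFunction.pmul_apply, ArithmeticFunction.pmul_apply, rpowArith_apply hn,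
    rpowArith_apply (left_ne_zero_of_mul hn), rpowArith_apply (right_ne_zero_of_mul hn),
    Nat.cast_mul, Real.mul_rpow (by positivity) (by positivity)]
  ring

theorem rpowArith_pmul_rpowArith (a b : ℝ) :
    (rpowArith a).pmul (rpowArith b) = rpowArith (a + b) := by
  ext n
  rcases eq_or_ne n 0 with rfl | hn
  · simp
  · rw [ArithmeticFunction.pmul_apply, rpowArith_apply hn, rpowArith_apply hn, rpowArith_apply hn,
      Real.rpow_add (by positivity)]

/-- The arithmetic function `n ↦ μ(n) n ^ e`, the Dirichlet inverse of `n ↦ n ^ e`. -/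
noncomputable def moebiusRpow (e : ℝ) : ArithmeticFunction ℝ :=
  (ArithmeticFunction.moebius : ArithmeticFunction ℝ).pmul (rpowArith e)

theorem moebiusRpow_mul_rpowArith (e : ℝ) : moebiusRpow e * rpowArith e = 1 := by
  have hzeta : rpowArith e = (ArithmeticFunction.zeta : ArithmeticFunction ℝ).pmul (rpowArith e) :=
    (ArithmeticFunction.zeta_pmul _).symm
  rw [moebiusRpow]
  nth_rewrite 2 [hzeta]
  rw [← mul_pmul_rpowArith, ArithmeticFunction.coe_moebius_mul_coe_zeta]
  ext n
  rw [ArithmeticFunction.pmul_apply, ArithmeticFunction.one_apply]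
  split_ifs with hn
  · rw [hn, rpowArith_apply one_ne_zero, Nat.cast_one, Real.one_rpow, mul_one]
  · exact zero_mul _

theorem zeta_mul_apply_gcd {R : Type*} [Semiring R] (f : ArithmeticFunction R) (q : ℕ) {k : ℕ}
    (hk : k ≠ 0) : ((ArithmeticFunction.zeta : ArithmeticFunction R) * f) (Nat.gcd q k) =
      ∑ d ∈ k.divisors, if d ∣ q then f d else 0 := by
  rw [ArithmeticFunction.coe_zeta_mul_apply, ← Finset.sum_filter]
  congr 1
  ext d
  simp only [Nat.mem_divisors, Finset.mem_filter, Nat.dvd_gcd_iff, ne_eq, Nat.gcd_eq_zero_iff]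
  tauto

/-! ### Sums over the integers -/

/-- The sum `∑ n ^ (-σ)` over the natural numbers, that is `ζ(σ)` for real `σ > 1`; the term
`n = 0` vanishes for `σ ≠ 0`. -/
noncomputable def zetaSum (σ : ℝ) : ℝ := ∑' n : ℕ, (n : ℝ) ^ (-σ)

theorem summable_natCast_rpow_neg {σ : ℝ} (hσ : 1 < σ) : Summable fun n : ℕ => (n : ℝ) ^ (-σ) :=
  Real.summable_nat_rpow.mpr (neg_lt_neg hσ)

theorem one_le_zetaSum {σ : ℝ} (hσ : 1 < σ) : 1 ≤ zetaSum σ := by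
  simpa [zetaSum] using (summable_natCast_rpow_neg hσ).le_tsum 1 fun n _ => by positivity

theorem riemannZeta_ofReal {σ : ℝ} (hσ : 1 < σ) : riemannZeta (σ : ℂ) = (zetaSum σ : ℂ) := by
  rw [zeta_eq_tsum_one_div_nat_cpow (by simpa using hσ), zetaSum, Complex.ofReal_tsum]
  refine tsum_congr fun n => ?_
  rw [Complex.ofReal_cpow (by positivity), Complex.ofReal_natCast, Complex.ofReal_neg,
    Complex.cpow_neg, one_div]

theorem tsum_abs_intCast_rpow_neg {σ : ℝ} (hσ : 1 < σ) :
    ∑' r : ℤ, |(r : ℝ)| ^ (-σ) = 2 * zetaSum σ := by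
  have h_zero : (0 : ℝ) ^ (-σ) = 0 := Real.zero_rpow (by linarith)
  rw [tsum_int_eq_zero_add_two_mul_tsum_pnat (fun r => by rw [Int.cast_neg, abs_neg])
    (Real.summable_abs_int_rpow hσ), zetaSum, ← tsum_zero_pnat_eq_tsum_nat
    (summable_natCast_rpow_neg hσ)]
  simp [h_zero]

theorem tsum_ite_dvd {R E : Type*} [MonoidWithZero R] [IsCancelMulZero R]
    [DecidableRel fun a b : R => a ∣ b] [AddCommMonoid E] [TopologicalSpace E] {g : R} (hg : g ≠ 0)
    (f : R → E) :
    ∑' r, (if g ∣ r then f r else 0) = ∑' s, f (g * s) := by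
  rw [← (mul_right_injective₀ hg).tsum_eq]
  · exact tsum_congr fun s => if_pos (dvd_mul_right g s)
  · intro r hr
    obtain ⟨s, rfl⟩ : g ∣ r := by_contra fun h => hr (if_neg h)
    exact ⟨s, rfl⟩

theorem tsum_ite_natCast_dvd_rpow {σ : ℝ} (hσ : 1 < σ) {g : ℕ} (hg : g ≠ 0) :
    ∑' r : ℤ, (if (g : ℤ) ∣ r then |(r : ℝ)| ^ (-σ) else 0) = (g : ℝ) ^ (-σ) * (2 * zetaSum σ) := by
  rw [tsum_ite_dvd (Nat.cast_ne_zero.mpr hg), ← tsum_abs_intCast_rpow_neg hσ, ← tsum_mul_left]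
  refine tsum_congr fun s => ?_
  rw [Int.cast_mul, Int.cast_natCast, abs_mul, Nat.abs_cast,
    Real.mul_rpow (by positivity) (by positivity)]

theorem tsum_ite_dvd_rpow (σ : ℝ) {d : ℕ} (hd : d ≠ 0) :
    ∑' q : ℕ, (if d ∣ q then (q : ℝ) ^ (-σ) else 0) = (d : ℝ) ^ (-σ) * zetaSum σ := by
  rw [tsum_ite_dvd hd, zetaSum, ← tsum_mul_left]
  refine tsum_congr fun s => ?_
  rw [Nat.cast_mul, Real.mul_rpow (by positivity) (by positivity)]

theorem gcd_rpow_mul_rpow_le {σ : ℝ} (hσ : 1 ≤ σ) (q : ℕ) {k : ℕ} (hk : 0 < k) :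
    (Nat.gcd q k : ℝ) ^ (1 - σ) * (q : ℝ) ^ (-σ) ≤ (q : ℝ) ^ (-σ) := by
  have hgcd : (1 : ℝ) ≤ Nat.gcd q k := by exact_mod_cast Nat.gcd_pos_of_pos_right _ hk
  exact mul_le_of_le_one_left (by positivity)
    (Real.rpow_le_one_of_one_le_of_nonpos hgcd (by linarith))

theorem tsum_gcd_rpow_le {σ : ℝ} (hσ : 1 < σ) {k : ℕ} (hk : 0 < k) :
    ∑' q : ℕ, (Nat.gcd q k : ℝ) ^ (1 - σ) * (q : ℝ) ^ (-σ) ≤ zetaSum σ :=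
  have hle := fun q : ℕ => gcd_rpow_mul_rpow_le hσ.le q hk
  have hsum := (summable_natCast_rpow_neg hσ).of_nonneg_of_le (fun q => by positivity) hle
  hsum.tsum_le_tsum hle (summable_natCast_rpow_neg hσ)

theorem tsum_gcd_rpow {σ : ℝ} (hσ : 1 < σ) {k : ℕ} (hk : 0 < k) :
    ∑' q : ℕ, (Nat.gcd q k : ℝ) ^ (1 - σ) * (q : ℝ) ^ (-σ) =
      zetaSum σ * ((ArithmeticFunction.zeta : ArithmeticFunction ℝ) *
        (moebiusRpow (-σ) * rpowArith (1 - 2 * σ))) k := by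
  set J := (ArithmeticFunction.moebius : ArithmeticFunction ℝ) * rpowArith (1 - σ) with hJ
  have hzetaJ : (ArithmeticFunction.zeta : ArithmeticFunction ℝ) * J = rpowArith (1 - σ) := by
    rw [hJ, ← mul_assoc, ArithmeticFunction.coe_zeta_mul_coe_moebius, one_mul]
  have hterm : ∀ q : ℕ, (Nat.gcd q k : ℝ) ^ (1 - σ) * (q : ℝ) ^ (-σ) =
      ∑ d ∈ k.divisors, J d * if d ∣ q then (q : ℝ) ^ (-σ) else 0 := by
    intro q
    rw [← rpowArith_apply (Nat.gcd_pos_of_pos_right q hk).ne', ← hzetaJ,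
      zeta_mul_apply_gcd J q hk.ne', Finset.sum_mul]
    exact Finset.sum_congr rfl fun d _ => by rw [ite_mul, zero_mul, mul_ite, mul_zero]
  have hsum : ∀ d : ℕ, Summable fun q : ℕ => J d * if d ∣ q then (q : ℝ) ^ (-σ) else 0 := by
    intro d
    refine Summable.mul_left (J d) ?_
    exact ((summable_natCast_rpow_neg hσ).indicator {q | d ∣ q}).congr fun q => by
      rw [Set.indicator_apply]; rfl
  have hJpmul : J.pmul (rpowArith (-σ)) = moebiusRpow (-σ) * rpowArith (1 - 2 * σ) := by
    rw [mul_pmul_rpowArith, rpowArith_pmul_rpowArith, moebiusRpow]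
    ring_nf
  rw [tsum_congr hterm, Summable.tsum_finsetSum fun d _ => hsum d, ← hJpmul,
    ArithmeticFunction.coe_zeta_mul_apply, Finset.mul_sum]
  refine Finset.sum_congr rfl fun d hd => ?_
  have hd0 : d ≠ 0 := (Nat.pos_of_mem_divisors hd).ne'
  rw [tsum_mul_left, tsum_ite_dvd_rpow σ hd0, ArithmeticFunction.pmul_apply, rpowArith_apply hd0]
  ring

/-! ### Sums over the lattice of a residue class -/

instance decidableMemCongruenceLattice (h : ℤ) (k : ℕ) (p : ℕ × ℤ) :
    Decidable (p ∈ congruenceLattice h k) := inferInstanceAs (Decidable ((k : ℤ) ∣ h * p.1 - p.2))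

/-- The sum of `(q |r|) ^ (-σ)` over the pairs `(q, r)` with `h q ≡ r` modulo `k`. The pairs with
`q r = 0` do not contribute if `σ ≠ 0`, since `0 ^ (-σ) = 0`. -/
noncomputable def congruenceSum (σ : ℝ) (h : ℤ) (k : ℕ) : ℝ :=
  ∑' p : congruenceLattice h k, pairHeight p ^ (-σ)

theorem pairHeight_rpow (σ : ℝ) (p : ℕ × ℤ) :
    pairHeight p ^ σ = (p.1 : ℝ) ^ σ * |(p.2 : ℝ)| ^ σ :=
  Real.mul_rpow (by positivity) (by positivity)

theorem summable_pairHeight_rpow_neg {σ : ℝ} (hσ : 1 < σ) :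
    Summable fun p => pairHeight p ^ (-σ) := by
  simp only [pairHeight_rpow]
  exact (summable_natCast_rpow_neg hσ).mul_of_nonneg (Real.summable_abs_int_rpow hσ)
    (fun n => by positivity) (fun n => by positivity)

theorem pairHeight_rpow_nonneg (σ : ℝ) (p : ℕ × ℤ) : 0 ≤ pairHeight p ^ σ :=
  Real.rpow_nonneg (pairHeight_nonneg p) σ

theorem congruenceSum_nonneg (σ : ℝ) (h : ℤ) (k : ℕ) : 0 ≤ congruenceSum σ h k :=
  tsum_nonneg fun _ => pairHeight_rpow_nonneg _ _

theorem exists_natCast_dvd_mul_sub_iff {q k : ℕ} (hk : 0 < k) (hqk : Nat.Coprime q k) (r : ℤ) :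
    ∃ c : ℕ, ∀ h : ℕ, (k : ℤ) ∣ h * q - r ↔ h ≡ c [MOD k] := by
  have : NeZero k := ⟨hk.ne'⟩
  refine ⟨(r * (ZMod.unitOfCoprime q hqk)⁻¹ : ZMod k).val, fun h => ?_⟩
  rw [← ZMod.natCast_eq_natCast_iff, ZMod.natCast_zmod_val, Units.eq_mul_inv_iff_mul_eq,
    ZMod.coe_unitOfCoprime, ← ZMod.intCast_zmod_eq_zero_iff_dvd]
  push_cast
  exact sub_eq_zero

theorem card_filter_Icc_modEq (c g : ℕ) {k : ℕ} (hk : 0 < k) :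
    ((Finset.Icc 1 (k * g)).filter (· ≡ c [MOD k])).card = g := by
  have hperiodic : Function.Periodic (· ≡ c [MOD k]) (k * g) := fun n => by
    simp [Nat.ModEq]
  rw [← Finset.Ico_add_one_right_eq_Icc, add_comm, Nat.filter_Ico_card_eq_of_periodic _ _ _
    hperiodic, Nat.count_modEq_card _ hk]
  simp [hk]

theorem card_filter_mem_congruenceLattice {k : ℕ} (hk : 0 < k) (p : ℕ × ℤ) :
    ((Finset.Icc 1 k).filter fun h : ℕ => p ∈ congruenceLattice h k).card =
      if ((Nat.gcd p.1 k : ℕ) : ℤ) ∣ p.2 then Nat.gcd p.1 k else 0 := by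
  obtain ⟨q, r⟩ := p
  dsimp only
  have hgcd : 0 < Nat.gcd q k := Nat.gcd_pos_of_pos_right _ hk
  split_ifs with hr
  · obtain ⟨r', rfl⟩ := hr
    obtain ⟨q', k', hco, hq, hk'⟩ := Nat.exists_coprime q k
    generalize Nat.gcd q k = g at *
    subst hq hk'
    have hk' : 0 < k' := Nat.pos_of_mul_pos_right hk
    obtain ⟨c, hc⟩ := exists_natCast_dvd_mul_sub_iff hk' hco r'
    refine (congrArg Finset.card (Finset.filter_congr fun h _ => ?_)).trans
      (card_filter_Icc_modEq c g hk')
    have hfactor : (h : ℤ) * (q' * g : ℕ) - g * r' = (h * q' - r') * g := by push_cast; ring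
    rw [mem_congruenceLattice, ← hc, hfactor, Nat.cast_mul,
      mul_dvd_mul_iff_right (Nat.cast_ne_zero.mpr hgcd.ne')]
  · rw [Finset.card_eq_zero, Finset.filter_eq_empty_iff]
    intro h _ hmem
    have hdvd : ((Nat.gcd q k : ℕ) : ℤ) ∣ h * q - r :=
      (Int.natCast_dvd_natCast.mpr (Nat.gcd_dvd_right q k)).trans hmem
    exact hr ((dvd_sub_right (dvd_mul_of_dvd_right
      (Int.natCast_dvd_natCast.mpr (Nat.gcd_dvd_left q k)) _)).mp hdvd)

theorem sum_congruenceSum {σ : ℝ} (hσ : 1 < σ) {k : ℕ} (hk : 0 < k) :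
    ∑ h ∈ Finset.Icc 1 k, congruenceSum σ h k =
      2 * zetaSum σ * ∑' q : ℕ, (Nat.gcd q k : ℝ) ^ (1 - σ) * (q : ℝ) ^ (-σ) := by
  have hsum : ∀ h ∈ Finset.Icc 1 k, Summable
      ((congruenceLattice h k).indicator fun p => pairHeight p ^ (-σ)) :=
    fun h _ => (summable_pairHeight_rpow_neg hσ).indicator _
  have hterm : ∀ p : ℕ × ℤ, (∑ h ∈ Finset.Icc 1 k,
      (congruenceLattice h k).indicator (fun p => pairHeight p ^ (-σ)) p) =
      (p.1 : ℝ) ^ (-σ) * (Nat.gcd p.1 k *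
        if ((Nat.gcd p.1 k : ℕ) : ℤ) ∣ p.2 then |(p.2 : ℝ)| ^ (-σ) else 0) := by
    intro p
    simp only [Set.indicator_apply]
    rw [← Finset.sum_filter, Finset.sum_const, card_filter_mem_congruenceLattice hk, nsmul_eq_mul,
      pairHeight_rpow, Nat.cast_ite, Nat.cast_zero, ite_mul, zero_mul, mul_ite, mul_ite, mul_zero,
      mul_zero, mul_left_comm]
  simp only [congruenceSum, tsum_subtype _ fun p => pairHeight p ^ (-σ)]
  rw [← Summable.tsum_finsetSum hsum, tsum_congr hterm,
    ((summable_congr hterm).mp (summable_sum hsum)).tsum_prod, ← tsum_mul_left]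
  refine tsum_congr fun q => ?_
  have hgcd : 0 < Nat.gcd q k := Nat.gcd_pos_of_pos_right _ hk
  dsimp only
  rw [tsum_mul_left, tsum_mul_left, tsum_ite_natCast_dvd_rpow hσ hgcd.ne', sub_eq_add_neg,
    Real.rpow_add (by positivity), Real.rpow_one]
  ring

theorem sum_congruenceSum_le {σ : ℝ} (hσ : 1 < σ) {k : ℕ} (hk : 0 < k) :
    ∑ h ∈ Finset.Icc 1 k, congruenceSum σ h k ≤ 2 * zetaSum σ ^ 2 := by
  rw [sum_congruenceSum hσ hk, sq, ← mul_assoc]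
  have hpos := one_le_zetaSum hσ
  exact mul_le_mul_of_nonneg_left (tsum_gcd_rpow_le hσ hk) (by linarith)

theorem congruenceLattice_mul_left {d : ℕ} (hd : d ≠ 0) (h : ℤ) (k : ℕ) :
    congruenceLattice (d * h) (d * k) =
      Prod.map id ((d : ℤ) * ·) '' congruenceLattice h k := by
  have hdvd : ∀ (q : ℕ) (s : ℤ),
      ((d * k : ℕ) : ℤ) ∣ d * h * q - d * s ↔ (k : ℤ) ∣ h * q - s := fun q s => by
    rw [Nat.cast_mul, mul_assoc, ← mul_sub, mul_dvd_mul_iff_left (Nat.cast_ne_zero.mpr hd)]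
  ext ⟨q, r⟩
  constructor
  · intro hmem
    have hd_dvd : (d : ℤ) ∣ d * h * q - r :=
      (Int.natCast_dvd_natCast.mpr (dvd_mul_right d k)).trans hmem
    obtain ⟨s, rfl⟩ := (dvd_sub_right (mul_assoc (d : ℤ) h q ▸ dvd_mul_right _ _)).mp hd_dvd
    exact ⟨(q, s), (hdvd q s).mp hmem, rfl⟩
  · rintro ⟨⟨q, s⟩, hmem, ⟨⟩⟩
    exact (hdvd q s).mpr hmem

theorem congruenceSum_mul_left (σ : ℝ) {d : ℕ} (hd : d ≠ 0) (h : ℤ) (k : ℕ) :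
    congruenceSum σ (d * h) (d * k) = (d : ℝ) ^ (-σ) * congruenceSum σ h k := by
  have hinj : Function.Injective (Prod.map id ((d : ℤ) * ·) : ℕ × ℤ → ℕ × ℤ) :=
    Function.injective_id.prodMap (mul_right_injective₀ (Nat.cast_ne_zero.mpr hd))
  unfold congruenceSum
  rw [congruenceLattice_mul_left hd, tsum_image (fun p => pairHeight p ^ (-σ)) hinj.injOn,
    ← tsum_mul_left]
  refine tsum_congr fun p => ?_
  rw [← Real.mul_rpow (by positivity) (pairHeight_nonneg _)]
  simp only [pairHeight, Prod.map_fst, Prod.map_snd, id_eq, Int.cast_mul, Int.cast_natCast, abs_mul,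
    Nat.abs_cast]
  rw [mul_left_comm]

theorem sum_Icc_one_eq_sum_divisorsAntidiagonal {M : Type*} [AddCommMonoid M] (f : ℕ → M) (k : ℕ) :
    ∑ h ∈ Finset.Icc 1 k, f h = ∑ x ∈ k.divisorsAntidiagonal,
      ∑ h ∈ (Finset.Icc 1 x.2).filter (fun h : ℕ => Nat.Coprime h x.2), f (x.1 * h) := by
  rcases k.eq_zero_or_pos with rfl | hk
  · simp
  rw [Nat.sum_divisorsAntidiagonal (fun d n =>
      ∑ h ∈ (Finset.Icc 1 n).filter (fun h : ℕ => Nat.Coprime h n), f (d * h)),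
    ← Finset.sum_fiberwise_of_maps_to (t := k.divisors) (g := fun h => Nat.gcd h k) fun h _ =>
      Nat.mem_divisors.mpr ⟨Nat.gcd_dvd_right h k, hk.ne'⟩]
  refine Finset.sum_congr rfl fun d hd => ?_
  obtain ⟨n, rfl⟩ := Nat.dvd_of_mem_divisors hd
  have hd0 : 0 < d := Nat.pos_of_mem_divisors hd
  rw [Nat.mul_div_cancel_left _ hd0,
    ← Finset.sum_image (f := f) (mul_right_injective₀ hd0.ne').injOn]
  congr 1
  ext h
  simp only [Finset.mem_filter, Finset.mem_image, Finset.mem_Icc]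
  constructor
  · rintro ⟨⟨h_pos, h_le⟩, hgcd⟩
    obtain ⟨h', rfl⟩ : d ∣ h := hgcd ▸ Nat.gcd_dvd_left h (d * n)
    rw [Nat.gcd_mul_left] at hgcd
    exact ⟨h', ⟨⟨Nat.pos_of_mul_pos_left h_pos, Nat.le_of_mul_le_mul_left h_le hd0⟩,
      Nat.eq_of_mul_eq_mul_left hd0 (hgcd.trans (mul_one d).symm)⟩, rfl⟩
  · rintro ⟨h', ⟨⟨h_pos, h_le⟩, hco⟩, rfl⟩
    refine ⟨⟨Nat.mul_pos hd0 h_pos, Nat.mul_le_mul_left _ h_le⟩, ?_⟩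
    rw [Nat.gcd_mul_left, hco, mul_one]

/-- The sum of `congruenceSum σ h k` over the residues `h` coprime to `k`. -/
noncomputable def coprimeCongruenceSum (σ : ℝ) : ArithmeticFunction ℝ :=
  ⟨fun k => ∑ h ∈ (Finset.Icc 1 k).filter (fun h : ℕ => Nat.Coprime h k), congruenceSum σ h k,
    by simp⟩

theorem coprimeCongruenceSum_apply (σ : ℝ) (k : ℕ) : coprimeCongruenceSum σ k =
    ∑ h ∈ (Finset.Icc 1 k).filter (fun h : ℕ => Nat.Coprime h k), congruenceSum σ h k := rfl

theorem rpowArith_mul_coprimeCongruenceSum (σ : ℝ) (k : ℕ) :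
    (rpowArith (-σ) * coprimeCongruenceSum σ) k = ∑ h ∈ Finset.Icc 1 k, congruenceSum σ h k := by
  rw [ArithmeticFunction.mul_apply, sum_Icc_one_eq_sum_divisorsAntidiagonal]
  refine Finset.sum_congr rfl fun x hx => ?_
  obtain ⟨rfl, hk⟩ := Nat.mem_divisorsAntidiagonal.mp hx
  have hd := left_ne_zero_of_mul hk
  rw [coprimeCongruenceSum_apply, rpowArith_apply hd, Finset.mul_sum]
  refine Finset.sum_congr rfl fun h _ => ?_
  rw [Nat.cast_mul, congruenceSum_mul_left σ hd]

theorem coprimeCongruenceSum_eq {σ : ℝ} (hσ : 1 < σ) :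
    coprimeCongruenceSum σ = (2 * zetaSum σ ^ 2) •
      ((ArithmeticFunction.zeta : ArithmeticFunction ℝ) *
        (moebiusRpow (-σ) * (moebiusRpow (-σ) * rpowArith (1 - 2 * σ)))) := by
  have hconv : rpowArith (-σ) * coprimeCongruenceSum σ = (2 * zetaSum σ ^ 2) •
      ((ArithmeticFunction.zeta : ArithmeticFunction ℝ) *
        (moebiusRpow (-σ) * rpowArith (1 - 2 * σ))) := by
    ext k
    rcases k.eq_zero_or_pos with rfl | hk
    · simp
    · rw [rpowArith_mul_coprimeCongruenceSum, sum_congruenceSum hσ hk, tsum_gcd_rpow hσ hk,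
        ArithmeticFunction.smul_map, smul_eq_mul]
      ring
  calc coprimeCongruenceSum σ
      = moebiusRpow (-σ) * (rpowArith (-σ) * coprimeCongruenceSum σ) := by
        rw [← mul_assoc, moebiusRpow_mul_rpowArith, one_mul]
    _ = _ := by rw [hconv, mul_smul_comm, mul_left_comm]

/-! ### Dirichlet series -/

theorem lSeriesHasSum_mul {f g : ArithmeticFunction ℝ} {s a b : ℂ}
    (hf : LSeriesHasSum (fun k => (f k : ℂ)) s a) (hg : LSeriesHasSum (fun k => (g k : ℂ)) s b) :
    LSeriesHasSum (fun k => ((f * g) k : ℂ)) s (a * b) := by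
  refine (LSeriesHasSum_congr s _ fun {n} _ => ?_).mp (hf.convolution hg)
  simp [LSeries.convolution_def, ArithmeticFunction.mul_apply]

theorem lSeriesHasSum_smul {f : ArithmeticFunction ℝ} {s a : ℂ} (c : ℝ)
    (hf : LSeriesHasSum (fun k => (f k : ℂ)) s a) :
    LSeriesHasSum (fun k => ((c • f) k : ℂ)) s (c * a) := by
  refine (LSeriesHasSum_congr s _ fun {n} _ => ?_).mp (hf.smul (c : ℂ))
  simp

theorem lSeriesHasSum_pmul_rpowArith {f : ArithmeticFunction ℝ} {s a : ℂ} (e : ℝ)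
    (hf : LSeriesHasSum (fun k => (f k : ℂ)) (s - e) a) :
    LSeriesHasSum (fun k => (f.pmul (rpowArith e) k : ℂ)) s a := by
  unfold LSeriesHasSum at hf ⊢
  convert hf using 1
  funext n
  rcases eq_or_ne n 0 with rfl | hn
  · simp
  · rw [LSeries.term_of_ne_zero hn, LSeries.term_of_ne_zero hn, ArithmeticFunction.pmul_apply,
      rpowArith_apply hn, Complex.ofReal_mul, Complex.ofReal_cpow (by positivity),
      Complex.cpow_sub _ _ (Nat.cast_ne_zero.mpr hn), Complex.ofReal_natCast, div_div_eq_mul_div]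

theorem lSeriesHasSum_natCoe_zeta {s : ℂ} (hs : 1 < s.re) :
    LSeriesHasSum (fun k => ((ArithmeticFunction.zeta : ArithmeticFunction ℝ) k : ℂ)) s
      (riemannZeta s) := by
  refine (LSeriesHasSum_congr s _ fun {n} _ => ?_).mp (ArithmeticFunction.LSeriesHasSum_zeta hs)
  simp [ArithmeticFunction.natCoe_apply, apply_ite (Complex.ofReal)]

theorem lSeriesHasSum_intCoe_moebius {s : ℂ} (hs : 1 < s.re) :
    LSeriesHasSum (fun k => ((ArithmeticFunction.moebius : ArithmeticFunction ℝ) k : ℂ)) s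
      (riemannZeta s)⁻¹ := by
  have hsum := (ArithmeticFunction.LSeriesSummable_moebius_iff.mpr hs).LSeriesHasSum
  have hinv := ArithmeticFunction.LSeries_zeta_mul_Lseries_moebius hs
  rw [ArithmeticFunction.LSeries_zeta_eq_riemannZeta hs] at hinv
  rw [eq_inv_of_mul_eq_one_right hinv] at hsum
  refine (LSeriesHasSum_congr s _ fun {n} _ => ?_).mp hsum
  simp [ArithmeticFunction.intCoe_apply]

theorem lSeriesHasSum_rpowArith {s : ℂ} {e : ℝ} (hs : 1 < (s - e).re) :
    LSeriesHasSum (fun k => (rpowArith e k : ℂ)) s (riemannZeta (s - e)) := by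
  simpa only [ArithmeticFunction.zeta_pmul] using
    lSeriesHasSum_pmul_rpowArith e (lSeriesHasSum_natCoe_zeta hs)

theorem lSeriesHasSum_moebiusRpow {s : ℂ} {e : ℝ} (hs : 1 < (s - e).re) :
    LSeriesHasSum (fun k => (moebiusRpow e k : ℂ)) s (riemannZeta (s - e))⁻¹ :=
  lSeriesHasSum_pmul_rpowArith e (lSeriesHasSum_intCoe_moebius hs)

/-- The Dirichlet series of `f` converges absolutely in the half-plane `Re s > 1`, with sum
`2 ζ(σ)² ζ(s + 2σ - 1) ζ(s) / (ζ(2σ) ζ(s + σ)²)`: the condition on the main term for the moment of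
real order `σ`, which for `σ = 2m` is `HasMomentFactorSeries m`. -/
def HasAbsMomentFactorSeries (σ : ℝ) (f : ArithmeticFunction ℝ) : Prop :=
  ∀ s : ℂ, 1 < s.re →
    LSeriesHasSum (fun k : ℕ => ((f k : ℝ) : ℂ)) s
      (2 * (riemannZeta σ ^ 2 * riemannZeta (s + 2 * σ - 1)) /
          (riemannZeta (2 * σ) * riemannZeta (s + σ) ^ 2) *
        riemannZeta s)

/-- The arithmetic function `f` in the main term `f(k) (k / 12) ^ σ` of the moment of real
order `σ`. -/
noncomputable def absMomentFactor (σ : ℝ) : ArithmeticFunction ℝ :=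
  (zetaSum (2 * σ))⁻¹ • coprimeCongruenceSum σ

theorem hasAbsMomentFactorSeries_absMomentFactor {σ : ℝ} (hσ : 1 < σ) :
    HasAbsMomentFactorSeries σ (absMomentFactor σ) := by
  intro s hs
  have hmoebius : LSeriesHasSum (fun k => (moebiusRpow (-σ) k : ℂ)) s (riemannZeta (s + σ))⁻¹ := by
    have := lSeriesHasSum_moebiusRpow (s := s) (e := -σ) (by
      simp only [Complex.sub_re, Complex.ofReal_re]; linarith)
    rwa [Complex.ofReal_neg, sub_neg_eq_add] at this
  have hrpow : LSeriesHasSum (fun k => (rpowArith (1 - 2 * σ) k : ℂ)) s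
      (riemannZeta (s + 2 * σ - 1)) := by
    have := lSeriesHasSum_rpowArith (s := s) (e := 1 - 2 * σ) (by
      simp only [Complex.sub_re, Complex.ofReal_re]; linarith)
    rwa [show s - ((1 - 2 * σ : ℝ) : ℂ) = s + 2 * σ - 1 by push_cast; ring] at this
  have hprod := lSeriesHasSum_smul (zetaSum (2 * σ))⁻¹ (lSeriesHasSum_smul (2 * zetaSum σ ^ 2)
    (lSeriesHasSum_mul (lSeriesHasSum_natCoe_zeta hs)
      (lSeriesHasSum_mul hmoebius (lSeriesHasSum_mul hmoebius hrpow))))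
  rw [← coprimeCongruenceSum_eq hσ] at hprod
  unfold absMomentFactor
  convert hprod using 1
  have hzeta_two : riemannZeta (2 * σ) = (zetaSum (2 * σ) : ℂ) := by
    exact_mod_cast riemannZeta_ofReal (show 1 < 2 * σ by linarith)
  rw [riemannZeta_ofReal hσ, hzeta_two, div_eq_mul_inv, mul_inv]
  push_cast
  ring

theorem HasAbsMomentFactorSeries.unique {σ : ℝ} {f g : ArithmeticFunction ℝ}
    (hf : HasAbsMomentFactorSeries σ f) (hg : HasAbsMomentFactorSeries σ g) : f = g := by
  have habscissa : ∀ {F : ArithmeticFunction ℝ}, HasAbsMomentFactorSeries σ F →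
      LSeries.abscissaOfAbsConv (fun k => (F k : ℂ)) < ⊤ := fun hF =>
    (LSeriesSummable.abscissaOfAbsConv_le (s := 2)
      (hF 2 (by norm_num)).LSeriesSummable).trans_lt (EReal.coe_lt_top _)
  ext n
  rcases eq_or_ne n 0 with rfl | hn
  · rw [f.map_zero, g.map_zero]
  · refine Complex.ofReal_injective (LSeries.eq_of_LSeries_eventually_eq (habscissa hf)
      (habscissa hg) ?_ hn)
    filter_upwards [Filter.eventually_gt_atTop (1 : ℝ)] with x hx
    rw [(hf x (by simpa using hx)).LSeries_eq, (hg x (by simpa using hx)).LSeries_eq]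

/-! ### Power estimates -/

theorem abs_rpow_sub_rpow_le {σ x y : ℝ} (hσ : 1 ≤ σ) (hx : 0 ≤ x) (hy : 0 ≤ y) :
    |x ^ σ - y ^ σ| ≤ σ * max x y ^ (σ - 1) * |x - y| := by
  wlog hyx : y ≤ x generalizing x y
  · rw [abs_sub_comm, max_comm, abs_sub_comm x]
    exact this hy hx (le_of_not_ge hyx)
  rcases hx.eq_or_lt with rfl | hx
  · simp [le_antisymm hyx hy]
  have hbernoulli : 1 + σ * (y / x - 1) ≤ (y / x) ^ σ := by
    have hratio : 0 ≤ y / x := by positivity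
    simpa using one_add_mul_self_le_rpow_one_add (s := y / x - 1) (by linarith) hσ
  have hpow : x ^ σ = x ^ (σ - 1) * x := by
    rw [← Real.rpow_add_one hx.ne', sub_add_cancel]
  rw [Real.div_rpow hy hx.le, le_div_iff₀ (by positivity)] at hbernoulli
  rw [max_eq_left hyx, abs_of_nonneg (sub_nonneg.mpr hyx),
    abs_of_nonneg (sub_nonneg.mpr (Real.rpow_le_rpow hy hyx (by linarith)))]
  calc x ^ σ - y ^ σ ≤ x ^ σ - (1 + σ * (y / x - 1)) * x ^ σ := sub_le_sub_left hbernoulli _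
    _ = σ * x ^ (σ - 1) * (x - y) := by rw [hpow]; field_simp; ring

theorem rpow_mul_rpow_neg_le {σ τ k n : ℝ} (hτσ : τ ≤ σ) (hk : 0 < k) (hn : 0 < n)
    (hkn : k ≤ 4 * n ^ 2) :
    k ^ σ * n ^ (-σ) ≤ 2 ^ (σ - τ) * k ^ ((σ + τ) / 2) * n ^ (-τ) := by
  have hroot : k ^ ((σ - τ) / 2) ≤ 2 ^ (σ - τ) * n ^ (σ - τ) := calc
    k ^ ((σ - τ) / 2) ≤ ((2 * n) ^ (2 : ℝ)) ^ ((σ - τ) / 2) := by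
        refine Real.rpow_le_rpow hk.le (hkn.trans_eq ?_) (by linarith)
        rw [Real.rpow_two]
        ring
    _ = 2 ^ (σ - τ) * n ^ (σ - τ) := by
        rw [← Real.rpow_mul (by positivity), mul_div_cancel₀ _ two_ne_zero,
          Real.mul_rpow zero_le_two hn.le]
  calc k ^ σ * n ^ (-σ) = k ^ ((σ - τ) / 2) * (k ^ ((σ + τ) / 2) * n ^ (-σ)) := by
        rw [← mul_assoc, ← Real.rpow_add hk]
        ring_nf
    _ ≤ 2 ^ (σ - τ) * n ^ (σ - τ) * (k ^ ((σ + τ) / 2) * n ^ (-σ)) := by gcongr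
    _ = 2 ^ (σ - τ) * k ^ ((σ + τ) / 2) * (n ^ (σ - τ) * n ^ (-σ)) := by ring
    _ = 2 ^ (σ - τ) * k ^ ((σ + τ) / 2) * n ^ (-τ) := by
        rw [← Real.rpow_add hn]
        ring_nf

theorem mul_div_rpow_sub_one_le {σ τ k n : ℝ} (hn : 1 ≤ n) (hkn : n ^ 2 ≤ k) :
    n * (k / n) ^ (σ - 1) ≤ (k ^ ((σ + τ) / 2) + k ^ (σ - 1)) * n ^ (-τ) := by
  have hn0 : 0 < n := by linarith
  have hk0 : 0 < k := by nlinarith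
  have hpow : n ^ (2 - σ + τ) * k ^ (σ - 1) ≤ k ^ ((σ + τ) / 2) + k ^ (σ - 1) := by
    rcases le_total (2 - σ + τ) 0 with hexp | hexp
    · have hle : n ^ (2 - σ + τ) * k ^ (σ - 1) ≤ k ^ (σ - 1) :=
        mul_le_of_le_one_left (by positivity) (Real.rpow_le_one_of_one_le_of_nonpos hn hexp)
      have hnonneg : 0 ≤ k ^ ((σ + τ) / 2) := by positivity
      linarith
    · have hroot : n ^ (2 - σ + τ) ≤ k ^ ((2 - σ + τ) / 2) := calc
        n ^ (2 - σ + τ) = (n ^ (2 : ℝ)) ^ ((2 - σ + τ) / 2) := by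
            rw [← Real.rpow_mul hn0.le, mul_div_cancel₀ _ two_ne_zero]
        _ ≤ k ^ ((2 - σ + τ) / 2) :=
            Real.rpow_le_rpow (by positivity) (by rwa [Real.rpow_two]) (by linarith)
      calc n ^ (2 - σ + τ) * k ^ (σ - 1) ≤ k ^ ((2 - σ + τ) / 2) * k ^ (σ - 1) := by gcongr
        _ = k ^ ((σ + τ) / 2) := by rw [← Real.rpow_add hk0]; ring_nf
        _ ≤ k ^ ((σ + τ) / 2) + k ^ (σ - 1) := le_add_of_nonneg_right (by positivity)
  calc n * (k / n) ^ (σ - 1) = n ^ (2 - σ + τ) * k ^ (σ - 1) * n ^ (-τ) := by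
        rw [Real.div_rpow hk0.le hn0.le, div_eq_mul_inv, ← Real.rpow_neg hn0.le, mul_right_comm,
          ← Real.rpow_add hn0, mul_left_comm]
        nth_rewrite 1 [← Real.rpow_one n]
        rw [← Real.rpow_add hn0, mul_comm]
        ring_nf
    _ ≤ (k ^ ((σ + τ) / 2) + k ^ (σ - 1)) * n ^ (-τ) := by gcongr

/-! ### Points of small height -/

theorem exists_forall_pairHeight_le {h k : ℕ} (hh : 0 < h) :
    ∃ p ∈ congruenceLattice h k, pairHeight p ≠ 0 ∧
      ∀ p' ∈ congruenceLattice h k, pairHeight p' ≠ 0 → pairHeight p ≤ pairHeight p' := by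
  have hcast : ∀ p, pairHeight p = (p.1 * p.2.natAbs : ℕ) := fun p => by
    rw [pairHeight, Nat.cast_mul, Nat.cast_natAbs, Int.cast_abs]
  have hnonempty : {p ∈ congruenceLattice h k | pairHeight p ≠ 0}.Nonempty :=
    ⟨(1, h), by simp [mem_congruenceLattice], by simp [pairHeight_ne_zero_iff, hh.ne']⟩
  obtain ⟨p, hp, hmin⟩ :=
    exists_minimalFor_of_wellFoundedLT _ (fun p : ℕ × ℤ => p.1 * p.2.natAbs) hnonempty
  refine ⟨p, hp.1, hp.2, fun p' hp' hp'0 => ?_⟩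
  rw [hcast, hcast, Nat.cast_le]
  exact (le_total _ _).elim id (hmin ⟨hp', hp'0⟩)

theorem exists_isCoprime_pairHeight_le {h : ℤ} {k : ℕ} {p : ℕ × ℤ}
    (hp : p ∈ congruenceLattice h k) (hp0 : pairHeight p ≠ 0) :
    ∃ (q : ℕ) (a r : ℤ), pairHeight (q, r) ≠ 0 ∧ IsCoprime a q ∧ q * h - a * k = r ∧
      pairHeight (q, r) ≤ pairHeight p := by
  obtain ⟨Q, R⟩ := p
  obtain ⟨A, hA : h * Q - R = k * A⟩ := hp
  obtain ⟨hQ0, hR0⟩ : Q ≠ 0 ∧ R ≠ 0 := pairHeight_ne_zero_iff.mp hp0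
  obtain ⟨g, a, q, hg, hco, rfl, hQ⟩ := Int.exists_gcd_one' (m := A) (n := Q)
    (Int.gcd_pos_of_ne_zero_right _ (by exact_mod_cast hQ0))
  have hq0 : 0 ≤ q := nonneg_of_mul_nonneg_left (hQ ▸ Int.natCast_nonneg Q) (by exact_mod_cast hg)
  lift q to ℕ using hq0
  obtain rfl : Q = q * g := by exact_mod_cast hQ
  obtain rfl : R = g * (q * h - a * k) := by push_cast at hA; linarith
  refine ⟨q, a, q * h - a * k, ?_, Int.isCoprime_iff_gcd_eq_one.mpr hco, rfl, ?_⟩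
  · exact pairHeight_ne_zero_iff.mpr ⟨left_ne_zero_of_mul hQ0, right_ne_zero_of_mul hR0⟩
  · have hg1 : (1 : ℝ) ≤ g := by exact_mod_cast hg
    simp only [pairHeight, Nat.cast_mul, Int.cast_mul, abs_mul, Int.cast_natCast, Nat.abs_cast]
    gcongr
    · exact le_mul_of_one_le_right (by positivity) hg1
    · exact le_mul_of_one_le_left (by positivity) hg1

theorem le_two_mul_pairHeight_mul_pairHeight {h : ℤ} {k : ℕ} {p p' : ℕ × ℤ}
    (hp : p ∈ congruenceLattice h k) (hp' : p' ∈ congruenceLattice h k)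
    (hp0 : pairHeight p ≠ 0) (hp'0 : pairHeight p' ≠ 0) (hne : p.1 * p'.2 ≠ p'.1 * p.2) :
    (k : ℝ) ≤ 2 * pairHeight p * pairHeight p' := by
  obtain ⟨q, r⟩ := p
  obtain ⟨q', r'⟩ := p'
  have hdvd : (k : ℤ) ∣ q * (h * q' - r') - q' * (h * q - r) :=
    dvd_sub (hp'.mul_left q) (hp.mul_left q')
  have hcombine : (q : ℤ) * (h * q' - r') - q' * (h * q - r) = q' * r - q * r' := by ring
  rw [hcombine] at hdvd
  have hdet : (k : ℝ) ≤ q' * |(r : ℝ)| + q * |(r' : ℝ)| := calc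
    (k : ℝ) ≤ |(q' * r - q * r' : ℝ)| := by
        exact_mod_cast Int.le_of_dvd (abs_pos.mpr (sub_ne_zero.mpr hne.symm))
          ((dvd_abs _ _).mpr hdvd)
    _ ≤ q' * |(r : ℝ)| + q * |(r' : ℝ)| := by
        refine (abs_sub _ _).trans_eq ?_
        simp only [abs_mul, Nat.abs_cast]
  obtain ⟨hq, hr⟩ := pairHeight_ne_zero_iff.mp hp0
  obtain ⟨hq', hr'⟩ := pairHeight_ne_zero_iff.mp hp'0
  have hcross : 1 ≤ q' * |(r : ℝ)| :=
    one_le_pairHeight (p := (q', r)) (pairHeight_ne_zero_iff.mpr ⟨hq', hr⟩)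
  have hcross' : 1 ≤ q * |(r' : ℝ)| :=
    one_le_pairHeight (p := (q, r')) (pairHeight_ne_zero_iff.mpr ⟨hq, hr'⟩)
  have hprod : pairHeight (q, r) * pairHeight (q', r') = q' * |(r : ℝ)| * (q * |(r' : ℝ)|) := by
    simp only [pairHeight]
    ring
  rw [mul_assoc, hprod]
  nlinarith

theorem setOf_mem_congruenceLattice_proportional {h a r : ℤ} {k q : ℕ} (hk : 0 < k) (hq : 0 < q)
    (haq : IsCoprime a q) (hdet : q * h - a * k = r) :
    {p ∈ congruenceLattice h k | p.1 * r = q * p.2} =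
      Set.range fun g : ℕ => (g * q, (g : ℤ) * r) := by
  ext ⟨Q, R⟩
  constructor
  · rintro ⟨⟨A, hA⟩, hprop⟩
    dsimp only at hA hprop
    have hAq : A * q = Q * a := by
      refine mul_right_cancel₀ (b := (k : ℤ)) (by exact_mod_cast hk.ne') ?_
      linear_combination (-(q : ℤ)) * hA + (Q : ℤ) * hdet + hprop
    obtain ⟨g, rfl⟩ : q ∣ Q := by
      have hdvd : (q : ℤ) ∣ Q * a := ⟨A, by linear_combination -hAq⟩
      exact_mod_cast haq.symm.dvd_of_dvd_mul_right hdvd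
    refine ⟨g, Prod.ext (mul_comm g q) ?_⟩
    refine mul_left_cancel₀ (a := (q : ℤ)) (by exact_mod_cast hq.ne') ?_
    rw [← hprop]
    push_cast
    ring
  · rintro ⟨g, hg⟩
    obtain ⟨rfl, rfl⟩ := Prod.mk.inj hg
    refine ⟨⟨g * a, ?_⟩, ?_⟩ <;> push_cast
    · linear_combination (g : ℤ) * hdet
    · ring

theorem tsum_proportional_pairHeight_rpow_neg {h a r : ℤ} {k q : ℕ} (σ : ℝ) (hk : 0 < k)
    (hq : 0 < q) (haq : IsCoprime a q) (hdet : q * h - a * k = r) :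
    ∑' p : {p ∈ congruenceLattice h k | p.1 * r = q * p.2}, pairHeight p ^ (-σ) =
      zetaSum (2 * σ) * pairHeight (q, r) ^ (-σ) := by
  have hinj : Function.Injective fun g : ℕ => (g * q, (g : ℤ) * r) := fun g g' hgg' =>
    Nat.eq_of_mul_eq_mul_right hq (congrArg Prod.fst hgg')
  rw [setOf_mem_congruenceLattice_proportional hk hq haq hdet,
    tsum_range (fun p => pairHeight p ^ (-σ)) hinj, zetaSum, ← tsum_mul_right]
  refine tsum_congr fun g => ?_
  have hheight : pairHeight (g * q, (g : ℤ) * r) = (g : ℝ) ^ (2 : ℝ) * pairHeight (q, r) := by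
    simp only [pairHeight, Nat.cast_mul, Int.cast_mul, abs_mul, Int.cast_natCast, Nat.abs_cast,
      Real.rpow_two]
    ring
  rw [hheight, Real.mul_rpow (by positivity) (pairHeight_nonneg _),
    ← Real.rpow_mul (by positivity), mul_neg]

theorem congruenceSum_eq_add_tsum {σ : ℝ} (hσ : 1 < σ) {h a r : ℤ} {k q : ℕ} (hk : 0 < k)
    (hq : 0 < q) (haq : IsCoprime a q) (hdet : q * h - a * k = r) :
    congruenceSum σ h k = zetaSum (2 * σ) * pairHeight (q, r) ^ (-σ) +
      ∑' p : {p ∈ congruenceLattice h k | p.1 * r ≠ q * p.2}, pairHeight p ^ (-σ) := by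
  have hsummable := summable_pairHeight_rpow_neg hσ
  have hunion : congruenceLattice h k = {p ∈ congruenceLattice h k | p.1 * r = q * p.2} ∪
      {p ∈ congruenceLattice h k | p.1 * r ≠ q * p.2} := by
    rw [← Set.sep_or]
    simp [em]
  rw [← tsum_proportional_pairHeight_rpow_neg σ hk hq haq hdet,
    ← Summable.tsum_union_disjoint (f := fun p => pairHeight p ^ (-σ))
      (Set.disjoint_left.mpr fun _ hp hp' => hp'.2 hp.2) (hsummable.subtype _)
      (hsummable.subtype _), ← hunion, congruenceSum]

theorem rpow_neg_le_congruenceSum {τ : ℝ} (hτ : 1 < τ) {h : ℤ} {k : ℕ} {p : ℕ × ℤ}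
    (hp : p ∈ congruenceLattice h k) : pairHeight p ^ (-τ) ≤ congruenceSum τ h k :=
  ((summable_pairHeight_rpow_neg hτ).subtype _).le_tsum (⟨p, hp⟩ : congruenceLattice h k)
    fun _ _ => pairHeight_rpow_nonneg _ _

theorem rpow_mul_tsum_pairHeight_rpow_neg_le {σ τ : ℝ} (hτ : 1 < τ) (hτσ : τ ≤ σ) {h : ℤ} {k : ℕ}
    (hk : 0 < k) {S : Set (ℕ × ℤ)} (hS : S ⊆ congruenceLattice h k)
    (hlarge : ∀ p ∈ S, pairHeight p ≠ 0 → k ≤ 4 * pairHeight p ^ 2) :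
    (k : ℝ) ^ σ * ∑' p : S, pairHeight p ^ (-σ) ≤
      2 ^ (σ - τ) * (k : ℝ) ^ ((σ + τ) / 2) * congruenceSum τ h k := by
  have hk0 : (0 : ℝ) < k := by exact_mod_cast hk
  have hsummable : ∀ {ρ : ℝ} (T : Set (ℕ × ℤ)), 1 < ρ → Summable fun p : T => pairHeight p ^ (-ρ) :=
    fun T hρ => (summable_pairHeight_rpow_neg hρ).subtype T
  have hterm : ∀ p : S, (k : ℝ) ^ σ * pairHeight p ^ (-σ) ≤
      2 ^ (σ - τ) * (k : ℝ) ^ ((σ + τ) / 2) * pairHeight p ^ (-τ) := by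
    intro p
    rcases eq_or_ne (pairHeight p) 0 with hp | hp
    · rw [hp, Real.zero_rpow (by linarith), Real.zero_rpow (by linarith), mul_zero, mul_zero]
    · exact rpow_mul_rpow_neg_le hτσ hk0 ((pairHeight_nonneg _).lt_of_ne' hp) (hlarge p p.2 hp)
  calc (k : ℝ) ^ σ * ∑' p : S, pairHeight p ^ (-σ)
      ≤ ∑' p : S, 2 ^ (σ - τ) * (k : ℝ) ^ ((σ + τ) / 2) * pairHeight p ^ (-τ) := by
        rw [← tsum_mul_left]
        exact ((hsummable S (hτ.trans_le hτσ)).mul_left _).tsum_le_tsum hterm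
          ((hsummable S hτ).mul_left _)
    _ ≤ 2 ^ (σ - τ) * (k : ℝ) ^ ((σ + τ) / 2) * congruenceSum τ h k := by
        rw [tsum_mul_left]
        refine mul_le_mul_of_nonneg_left ?_ (by positivity)
        exact Summable.tsum_le_tsum_of_inj (Set.inclusion hS) (Set.inclusion_injective hS)
          (fun _ _ => pairHeight_rpow_nonneg _ _) (fun _ => le_rfl) (hsummable S hτ)
          (hsummable _ hτ)

theorem rpow_mul_tsum_not_proportional_le {σ τ : ℝ} (hτ : 1 < τ) (hτσ : τ ≤ σ) {h r : ℤ} {k q : ℕ}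
    (hk : 0 < k) (hqr : (q, r) ∈ congruenceLattice h k) (hqr0 : pairHeight (q, r) ≠ 0)
    (hsmall : 4 * pairHeight (q, r) ^ 2 ≤ k) :
    (k : ℝ) ^ σ * ∑' p : {p ∈ congruenceLattice h k | p.1 * r ≠ q * p.2}, pairHeight p ^ (-σ) ≤
      2 ^ (σ - τ) * (k : ℝ) ^ ((σ + τ) / 2) * congruenceSum τ h k := by
  refine rpow_mul_tsum_pairHeight_rpow_neg_le hτ hτσ hk (fun _ hp => hp.1) ?_
  rintro p ⟨hp, hne⟩ hp0
  have hprod := le_two_mul_pairHeight_mul_pairHeight hqr hp hqr0 hp0 hne.symm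
  nlinarith [sq_nonneg (pairHeight (q, r) - pairHeight p)]

/-! ### Pointwise approximation of powers of Dedekind sums -/

theorem abs_dedekindSum_rpow_le {σ τ : ℝ} (hτ : 1 < τ) (hτσ : τ ≤ σ) {h k : ℕ} (hh : 0 < h)
    (hhk : h ≤ k) (hc : Nat.Coprime h k)
    (hlarge : ∀ p ∈ congruenceLattice h k, pairHeight p ≠ 0 → k ≤ 4 * pairHeight p ^ 2) :
    |12 * dedekindSum h k| ^ σ ≤ 12 ^ σ * 2 ^ (σ - τ) * (1 + Real.log k) ^ σ *
      (k : ℝ) ^ ((σ + τ) / 2) * congruenceSum τ h k := by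
  obtain ⟨p, hp, hp0, hmin⟩ := exists_forall_pairHeight_le (k := k) hh
  have hk : (0 : ℝ) < k := by exact_mod_cast hh.trans_le hhk
  have hn : 0 < pairHeight p := (pairHeight_nonneg p).lt_of_ne' hp0
  have hlog : 0 ≤ 1 + Real.log k := by
    have := Real.log_natCast_nonneg k
    linarith
  have hD := abs_dedekindSum_le_log hh hhk hc (M := k / pairHeight p) fun p' hp' hp'0 =>
    calc (k : ℝ) = k / pairHeight p * pairHeight p := (div_mul_cancel₀ _ hp0).symm
      _ ≤ k / pairHeight p * pairHeight p' :=
        mul_le_mul_of_nonneg_left (hmin p' hp' hp'0) (by positivity)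
  calc |12 * dedekindSum h k| ^ σ
      ≤ (12 * (k / pairHeight p) * (1 + Real.log k)) ^ σ :=
        Real.rpow_le_rpow (abs_nonneg _) hD (by linarith)
    _ = 12 ^ σ * (1 + Real.log k) ^ σ * ((k : ℝ) ^ σ * pairHeight p ^ (-σ)) := by
        rw [Real.mul_rpow (by positivity) hlog, Real.mul_rpow (by positivity) (by positivity),
          Real.div_rpow hk.le hn.le, Real.rpow_neg hn.le]
        ring
    _ ≤ 12 ^ σ * (1 + Real.log k) ^ σ *
          (2 ^ (σ - τ) * (k : ℝ) ^ ((σ + τ) / 2) * congruenceSum τ h k) := by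
        refine mul_le_mul_of_nonneg_left ?_ (by positivity)
        exact (rpow_mul_rpow_neg_le hτσ hk hn (hlarge p hp hp0)).trans
          (mul_le_mul_of_nonneg_left (rpow_neg_le_congruenceSum hτ hp) (by positivity))
    _ = _ := by ring

theorem abs_abs_rpow_sub_rpow_le {σ τ k n D A : ℝ} (hσ : 1 ≤ σ) (hn : 1 ≤ n)
    (hkn : 4 * n ^ 2 ≤ k) (hA : |A| = k / n) (hDA : |D - A| ≤ 11 * n) :
    |(|D| ^ σ - |A| ^ σ)| ≤
      11 * σ * 4 ^ (σ - 1) * ((k ^ ((σ + τ) / 2) + k ^ (σ - 1)) * n ^ (-τ)) := by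
  have hn0 : 0 < n := by linarith
  have hk0 : 0 < k := by nlinarith
  have hkn' : 4 * n ≤ k / n := by
    rw [le_div_iff₀ hn0]
    linarith
  have hmax : max |D| |A| ≤ 4 * (k / n) := by
    have hD := abs_sub_abs_le_abs_sub D A
    exact max_le (by linarith) (by linarith)
  calc |(|D| ^ σ - |A| ^ σ)| ≤ σ * max |D| |A| ^ (σ - 1) * |(|D| - |A|)| :=
        abs_rpow_sub_rpow_le hσ (abs_nonneg _) (abs_nonneg _)
    _ ≤ σ * (4 * (k / n)) ^ (σ - 1) * (11 * n) := by
        gcongr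
        exact (abs_abs_sub_abs_le _ _).trans hDA
    _ = 11 * σ * 4 ^ (σ - 1) * (n * (k / n) ^ (σ - 1)) := by
        rw [Real.mul_rpow zero_le_four (by linarith : 0 ≤ k / n)]
        ring
    _ ≤ 11 * σ * 4 ^ (σ - 1) * ((k ^ ((σ + τ) / 2) + k ^ (σ - 1)) * n ^ (-τ)) :=
        mul_le_mul_of_nonneg_left (mul_div_rpow_sub_one_le hn (by nlinarith)) (by positivity)

theorem abs_dedekindSum_rpow_sub_rpow_le {σ τ : ℝ} (hσ : 1 ≤ σ) {h a r : ℤ} {k q : ℕ} (hk : 0 < k)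
    (hhk : IsCoprime h k) (haq : IsCoprime a q) (hdet : q * h - a * k = r)
    (hqr0 : pairHeight (q, r) ≠ 0) (hsmall : 4 * pairHeight (q, r) ^ 2 ≤ k) :
    |(|12 * dedekindSum h k| ^ σ - (k : ℝ) ^ σ * pairHeight (q, r) ^ (-σ))| ≤
      11 * σ * 4 ^ (σ - 1) *
        (((k : ℝ) ^ ((σ + τ) / 2) + (k : ℝ) ^ (σ - 1)) * pairHeight (q, r) ^ (-τ)) := by
  obtain ⟨hq, hr⟩ : q ≠ 0 ∧ r ≠ 0 := pairHeight_ne_zero_iff.mp hqr0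
  have habs : |k / (q * r : ℝ)| = k / pairHeight (q, r) := by
    rw [abs_div, abs_mul, Nat.abs_cast, Nat.abs_cast, pairHeight]
  have hmodel : |k / (q * r : ℝ)| ^ σ = (k : ℝ) ^ σ * pairHeight (q, r) ^ (-σ) := by
    rw [habs, Real.div_rpow k.cast_nonneg (pairHeight_nonneg _),
      Real.rpow_neg (pairHeight_nonneg _), div_eq_mul_inv]
  rw [← hmodel]
  exact abs_abs_rpow_sub_rpow_le hσ (one_le_pairHeight hqr0) hsmall habs
    (abs_dedekindSum_sub_le (Nat.pos_of_ne_zero hq) hk hr hhk haq hdet)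

theorem abs_dedekindSum_rpow_sub_congruenceSum_le_of_small {σ τ : ℝ} (hτ : 1 < τ) (hτσ : τ ≤ σ)
    {h a r : ℤ} {k q : ℕ} (hk : 0 < k) (hhk : IsCoprime h k) (haq : IsCoprime a q)
    (hdet : q * h - a * k = r) (hqr0 : pairHeight (q, r) ≠ 0)
    (hsmall : 4 * pairHeight (q, r) ^ 2 ≤ k) :
    |(|12 * dedekindSum h k| ^ σ - (k : ℝ) ^ σ * ((zetaSum (2 * σ))⁻¹ * congruenceSum σ h k))| ≤
      (11 * σ * 4 ^ (σ - 1) + 2 ^ (σ - τ)) *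
        (((k : ℝ) ^ ((σ + τ) / 2) + (k : ℝ) ^ (σ - 1)) * congruenceSum τ h k) := by
  have hσ := hτ.trans_le hτσ
  have hqr : (q, r) ∈ congruenceLattice h k := ⟨a, by dsimp only; linear_combination hdet⟩
  have hq : 0 < q := Nat.pos_of_ne_zero (pairHeight_ne_zero_iff.mp hqr0).1
  have hmain := abs_dedekindSum_rpow_sub_rpow_le (τ := τ) hσ.le hk hhk haq hdet hqr0 hsmall
  have hrest := rpow_mul_tsum_not_proportional_le hτ hτσ hk hqr hqr0 hsmall
  have hzeta := one_le_zetaSum (σ := 2 * σ) (by linarith)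
  rw [congruenceSum_eq_add_tsum hσ hk hq haq hdet]
  set n := pairHeight (q, r)
  set R := ∑' p : {p ∈ congruenceLattice h k | p.1 * r ≠ q * p.2}, pairHeight p ^ (-σ)
  calc |(|12 * dedekindSum h k| ^ σ -
        (k : ℝ) ^ σ * ((zetaSum (2 * σ))⁻¹ * (zetaSum (2 * σ) * n ^ (-σ) + R)))|
      = |(|12 * dedekindSum h k| ^ σ - (k : ℝ) ^ σ * n ^ (-σ) -
          (zetaSum (2 * σ))⁻¹ * ((k : ℝ) ^ σ * R))| := by
        congr 1
        field_simp
        ring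
    _ ≤ 11 * σ * 4 ^ (σ - 1) * (((k : ℝ) ^ ((σ + τ) / 2) + (k : ℝ) ^ (σ - 1)) * n ^ (-τ)) +
        (k : ℝ) ^ σ * R := by
        refine (abs_sub _ _).trans (add_le_add hmain ?_)
        have hR : 0 ≤ (k : ℝ) ^ σ * R :=
          mul_nonneg (by positivity) (tsum_nonneg fun _ => pairHeight_rpow_nonneg _ _)
        rw [abs_of_nonneg (by positivity)]
        exact mul_le_of_le_one_left hR (inv_le_one_of_one_le₀ hzeta)
    _ ≤ 11 * σ * 4 ^ (σ - 1) *
          (((k : ℝ) ^ ((σ + τ) / 2) + (k : ℝ) ^ (σ - 1)) * congruenceSum τ h k) +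
        2 ^ (σ - τ) *
          (((k : ℝ) ^ ((σ + τ) / 2) + (k : ℝ) ^ (σ - 1)) * congruenceSum τ h k) := by
        have hC := congruenceSum_nonneg τ h k
        refine add_le_add ?_ (hrest.trans ?_)
        · gcongr
          exact rpow_neg_le_congruenceSum hτ hqr
        · rw [mul_assoc]
          gcongr
          exact le_add_of_nonneg_right (by positivity)
    _ = _ := by ring

theorem abs_dedekindSum_rpow_sub_congruenceSum_le_of_large {σ τ : ℝ} (hτ : 1 < τ) (hτσ : τ ≤ σ)
    {h k : ℕ} (hh : 0 < h) (hhk : h ≤ k) (hc : Nat.Coprime h k)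
    (hlarge : ∀ p ∈ congruenceLattice h k, pairHeight p ≠ 0 → k ≤ 4 * pairHeight p ^ 2) :
    |(|12 * dedekindSum h k| ^ σ - (k : ℝ) ^ σ * ((zetaSum (2 * σ))⁻¹ * congruenceSum σ h k))| ≤
      (12 ^ σ * (1 + Real.log k) ^ σ + 1) * 2 ^ (σ - τ) *
        ((k : ℝ) ^ ((σ + τ) / 2) * congruenceSum τ h k) := by
  have hD := abs_dedekindSum_rpow_le hτ hτσ hh hhk hc hlarge
  have hsum : (k : ℝ) ^ σ * congruenceSum σ h k ≤
      2 ^ (σ - τ) * (k : ℝ) ^ ((σ + τ) / 2) * congruenceSum τ h k :=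
    rpow_mul_tsum_pairHeight_rpow_neg_le hτ hτσ (hh.trans_le hhk) subset_rfl hlarge
  have hzeta := one_le_zetaSum (σ := 2 * σ) (by linarith)
  have hC0 := congruenceSum_nonneg σ h k
  have hC : (k : ℝ) ^ σ * ((zetaSum (2 * σ))⁻¹ * congruenceSum σ h k) ≤
      (k : ℝ) ^ σ * congruenceSum σ h k := by
    gcongr
    exact mul_le_of_le_one_left hC0 (inv_le_one_of_one_le₀ hzeta)
  have hD0 : 0 ≤ |12 * dedekindSum h k| ^ σ := by positivity
  have hmodel0 : 0 ≤ (k : ℝ) ^ σ * ((zetaSum (2 * σ))⁻¹ * congruenceSum σ h k) := by positivity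
  refine (abs_sub _ _).trans ?_
  rw [abs_of_nonneg hD0, abs_of_nonneg hmodel0]
  linear_combination hD + hC + hsum

theorem abs_dedekindSum_rpow_sub_congruenceSum_le {σ τ : ℝ} (hτ : 1 < τ) (hτσ : τ ≤ σ)
    {h k : ℕ} (hh : 0 < h) (hhk : h ≤ k) (hc : Nat.Coprime h k) :
    |(|12 * dedekindSum h k| ^ σ - (k : ℝ) ^ σ * ((zetaSum (2 * σ))⁻¹ * congruenceSum σ h k))| ≤
      (11 * σ * 4 ^ (σ - 1) + (12 ^ σ + 1) * 2 ^ (σ - τ)) * (1 + Real.log k) ^ σ *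
        (((k : ℝ) ^ ((σ + τ) / 2) + (k : ℝ) ^ (σ - 1)) * congruenceSum τ h k) := by
  have hσ : 0 < σ := by linarith
  have hk := hh.trans_le hhk
  have hC := congruenceSum_nonneg τ h k
  have hlog : 1 ≤ (1 + Real.log k) ^ σ :=
    Real.one_le_rpow (le_add_of_nonneg_right (Real.log_natCast_nonneg k)) hσ.le
  by_cases hlarge : ∀ p ∈ congruenceLattice h k, pairHeight p ≠ 0 → k ≤ 4 * pairHeight p ^ 2
  · refine (abs_dedekindSum_rpow_sub_congruenceSum_le_of_large hτ hτσ hh hhk hc hlarge).trans ?_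
    have hpow : 2 ^ (σ - τ) ≤ 2 ^ (σ - τ) * (1 + Real.log k) ^ σ :=
      le_mul_of_one_le_right (by positivity) hlog
    have hmain0 : 0 ≤ 11 * σ * 4 ^ (σ - 1) * (1 + Real.log k) ^ σ := by positivity
    refine mul_le_mul ?_ ?_ (by positivity) (by positivity)
    · linear_combination hpow + hmain0
    · gcongr
      exact le_add_of_nonneg_right (by positivity)
  · push Not at hlarge
    obtain ⟨p, hp, hp0, hlt⟩ := hlarge
    obtain ⟨q, a, r, hqr0, haq, hdet, hle⟩ := exists_isCoprime_pairHeight_le hp hp0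
    have hsmall : 4 * pairHeight (q, r) ^ 2 ≤ k := by
      have hnonneg := pairHeight_nonneg (q, r)
      nlinarith
    refine (abs_dedekindSum_rpow_sub_congruenceSum_le_of_small hτ hτσ hk
      (Nat.isCoprime_iff_coprime.mpr hc) haq hdet hqr0 hsmall).trans ?_
    gcongr
    refine (le_mul_of_one_le_right (by positivity) hlog).trans ?_
    gcongr
    exact le_mul_of_one_le_left (by positivity) (le_add_of_nonneg_left (by positivity))

/-! ### Moments of Dedekind sums -/

theorem abs_sum_dedekindSum_rpow_sub_le {σ τ : ℝ} (hτ : 1 < τ) (hτσ : τ ≤ σ) {k : ℕ}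
    (hk : 0 < k) :
    |∑ h ∈ (Finset.Icc 1 k).filter (fun h : ℕ => Nat.Coprime h k), |dedekindSum h k| ^ σ -
        absMomentFactor σ k * ((k : ℝ) / 12) ^ σ| ≤
      (11 * σ * 4 ^ (σ - 1) + (12 ^ σ + 1) * 2 ^ (σ - τ)) * (2 * zetaSum τ ^ 2) *
        ((1 + Real.log k) ^ σ * ((k : ℝ) ^ ((σ + τ) / 2) + (k : ℝ) ^ (σ - 1))) := by
  set S := (Finset.Icc 1 k).filter fun h : ℕ => Nat.Coprime h k with hS
  set C : ℝ := 11 * σ * 4 ^ (σ - 1) + (12 ^ σ + 1) * 2 ^ (σ - τ)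
  set W : ℝ := (k : ℝ) ^ ((σ + τ) / 2) + (k : ℝ) ^ (σ - 1)
  have hσ : 0 < σ := by linarith
  have : 0 ≤ 1 + Real.log k := add_nonneg zero_le_one (Real.log_natCast_nonneg k)
  have hscale : ∑ h ∈ S, |dedekindSum h k| ^ σ - absMomentFactor σ k * ((k : ℝ) / 12) ^ σ =
      (12 ^ σ)⁻¹ * ∑ h ∈ S, (|12 * dedekindSum h k| ^ σ -
        (k : ℝ) ^ σ * ((zetaSum (2 * σ))⁻¹ * congruenceSum σ h k)) := by
    have hpow : ∀ h : ℕ, |12 * dedekindSum h k| ^ σ = 12 ^ σ * |dedekindSum h k| ^ σ := fun h => by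
      rw [abs_mul, Nat.abs_ofNat, Real.mul_rpow (by positivity) (abs_nonneg _)]
    simp only [hpow]
    rw [Finset.sum_sub_distrib, ← Finset.mul_sum, ← Finset.mul_sum, ← Finset.mul_sum,
      absMomentFactor, ArithmeticFunction.smul_map, coprimeCongruenceSum_apply, ← hS,
      smul_eq_mul, Real.div_rpow (by positivity) (by positivity)]
    field_simp
  have hsum : ∑ h ∈ S, congruenceSum τ h k ≤ 2 * zetaSum τ ^ 2 :=
    (Finset.sum_le_sum_of_subset_of_nonneg (Finset.filter_subset _ _)
      fun h _ _ => congruenceSum_nonneg _ _ _).trans (sum_congruenceSum_le hτ hk)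
  rw [hscale, abs_mul, abs_of_nonneg (by positivity)]
  calc (12 ^ σ)⁻¹ * |∑ h ∈ S, (|12 * dedekindSum h k| ^ σ -
        (k : ℝ) ^ σ * ((zetaSum (2 * σ))⁻¹ * congruenceSum σ h k))|
      ≤ |∑ h ∈ S, (|12 * dedekindSum h k| ^ σ -
        (k : ℝ) ^ σ * ((zetaSum (2 * σ))⁻¹ * congruenceSum σ h k))| :=
        mul_le_of_le_one_left (abs_nonneg _)
          (inv_le_one_of_one_le₀ (Real.one_le_rpow (by norm_num) hσ.le))
    _ ≤ ∑ h ∈ S, C * (1 + Real.log k) ^ σ * (W * congruenceSum τ h k) := by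
        refine (Finset.abs_sum_le_sum_abs _ _).trans (Finset.sum_le_sum fun h hh => ?_)
        rw [hS, Finset.mem_filter, Finset.mem_Icc] at hh
        exact abs_dedekindSum_rpow_sub_congruenceSum_le hτ hτσ hh.1.1 hh.1.2 hh.2
    _ = C * (1 + Real.log k) ^ σ * (W * ∑ h ∈ S, congruenceSum τ h k) := by
        rw [Finset.mul_sum, Finset.mul_sum]
    _ ≤ C * (1 + Real.log k) ^ σ * (W * (2 * zetaSum τ ^ 2)) := by gcongr
    _ = _ := by ring

theorem one_add_log_rpow_mul_rpow_isBigO {σ : ℝ} (hσ : 0 ≤ σ) {a e : ℝ} (hae : a < e) :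
    (fun k : ℕ => (1 + Real.log k) ^ σ * (k : ℝ) ^ a) =O[Filter.atTop]
      fun k : ℕ => (k : ℝ) ^ e := by
  have hlog : (fun x : ℝ => 1 + Real.log x) =O[Filter.atTop] Real.log :=
    (Real.isLittleO_const_log_atTop.isBigO).add (Asymptotics.isBigO_refl _ _)
  have hpow : (fun x : ℝ => (1 + Real.log x) ^ σ) =O[Filter.atTop] fun x => x ^ (e - a) :=
    (hlog.rpow hσ (Real.tendsto_log_atTop.eventually_ge_atTop 0)).trans
      (isLittleO_log_rpow_rpow_atTop σ (sub_pos.mpr hae)).isBigO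
  have hmul : (fun x : ℝ => (1 + Real.log x) ^ σ * x ^ a) =O[Filter.atTop] fun x => x ^ e := by
    refine (hpow.mul (Asymptotics.isBigO_refl (fun x : ℝ => x ^ a) _)).congr' .rfl ?_
    filter_upwards [Filter.eventually_gt_atTop 0] with x hx
    rw [← Real.rpow_add hx, sub_add_cancel]
  exact hmul.comp_tendsto tendsto_natCast_atTop_atTop

theorem sum_abs_dedekindSum_rpow_sub_isBigO {σ e : ℝ} (hσ : 1 < σ) (he : (σ + 1) / 2 < e)
    (he' : σ - 1 < e) :
    (fun k : ℕ => ∑ h ∈ (Finset.Icc 1 k).filter (fun h : ℕ => Nat.Coprime h k),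
        |dedekindSum h k| ^ σ - absMomentFactor σ k * ((k : ℝ) / 12) ^ σ)
      =O[Filter.atTop] fun k : ℕ => (k : ℝ) ^ e := by
  obtain ⟨τ, hτ, hτσe⟩ : ∃ τ, 1 < τ ∧ τ < min σ (2 * e - σ) :=
    exists_between (lt_min hσ (by linarith))
  have hσ0 : 0 ≤ σ := by linarith
  obtain ⟨hτσ, hτe⟩ := lt_min_iff.mp hτσe
  refine Asymptotics.IsBigO.trans (Asymptotics.IsBigO.of_bound
      ((11 * σ * 4 ^ (σ - 1) + (12 ^ σ + 1) * 2 ^ (σ - τ)) * (2 * zetaSum τ ^ 2)) ?_)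
    ((one_add_log_rpow_mul_rpow_isBigO hσ0 (show (σ + τ) / 2 < e by linarith)).add
      (one_add_log_rpow_mul_rpow_isBigO hσ0 he'))
  filter_upwards [Filter.eventually_gt_atTop 0] with k hk
  refine (abs_sum_dedekindSum_rpow_sub_le hτ hτσ.le hk).trans ?_
  rw [← mul_add]
  gcongr
  exact Real.le_norm_self _

theorem theorem2_general {σ : ℝ} (hσ : 1 < σ) :
    (∃! f : ArithmeticFunction ℝ, HasAbsMomentFactorSeries σ f) ∧
    ∀ f : ArithmeticFunction ℝ, HasAbsMomentFactorSeries σ f →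
      ∀ e : ℝ, (σ + 1) / 2 < e → σ - 1 < e →
        (fun k : ℕ => ∑ h ∈ (Finset.Icc 1 k).filter (fun h : ℕ => Nat.Coprime h k),
            |dedekindSum h k| ^ σ - f k * ((k : ℝ) / 12) ^ σ)
          =O[Filter.atTop] fun k : ℕ => (k : ℝ) ^ e := by
  have hf := hasAbsMomentFactorSeries_absMomentFactor hσ
  refine ⟨⟨absMomentFactor σ, hf, fun g hg => hg.unique hf⟩, fun g hg e he he' => ?_⟩
  rw [hg.unique hf]
  exact sum_abs_dedekindSum_rpow_sub_isBigO hσ he he'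

/-! ### Even moments -/

theorem hasMomentFactorSeries_iff {m : ℕ} {f : ArithmeticFunction ℝ} :
    HasMomentFactorSeries m f ↔ HasAbsMomentFactorSeries (2 * m) f := by
  have hfour : (4 * m : ℂ) = 2 * (2 * m) := by ring
  simp only [HasMomentFactorSeries, HasAbsMomentFactorSeries, hfour]
  push_cast
  rfl

theorem rpow_two_mul_natCast (x : ℝ) (m : ℕ) : x ^ (2 * (m : ℝ)) = x ^ (2 * m) := by
  rw [← Real.rpow_natCast, Nat.cast_mul, Nat.cast_ofNat]

theorem isBigO_mul_log_pow {g : ℕ → ℝ} (n : ℕ) :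
    g =O[Filter.atTop] fun k : ℕ => g k * Real.log k ^ n := by
  refine Asymptotics.IsBigO.of_bound 1 ?_
  filter_upwards [(Real.tendsto_log_atTop.comp tendsto_natCast_atTop_atTop).eventually_ge_atTop 1]
    with k (hk : 1 ≤ Real.log k)
  rw [one_mul, norm_mul, norm_pow, Real.norm_of_nonneg (zero_le_one.trans hk)]
  exact le_mul_of_one_le_right (norm_nonneg _) (one_le_pow₀ hk)

theorem exists_rpow_isBigO {m : ℕ} (hm : 1 ≤ m) :
    ∃ e : ℝ, (2 * (m : ℝ) + 1) / 2 < e ∧ 2 * (m : ℝ) - 1 < e ∧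
      (fun k : ℕ => (k : ℝ) ^ e) =O[Filter.atTop] fun k : ℕ =>
        ((k : ℝ) ^ (9 / 5 : ℝ) + (k : ℝ) ^ (2 * (m : ℝ) - 1 + 1 / ((m : ℝ) + 1))) *
          Real.log (k : ℝ) ^ 3 := by
  have hsum {e : ℝ} (b c : ℝ) (he : e = b ∨ e = c) :
      (fun k : ℕ => (k : ℝ) ^ e) =O[Filter.atTop] fun k : ℕ => (k : ℝ) ^ b + (k : ℝ) ^ c := by
    refine Asymptotics.IsBigO.of_bound' (.of_forall fun k => ?_)
    rw [Real.norm_of_nonneg (by positivity), Real.norm_of_nonneg (by positivity)]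
    rcases he with rfl | rfl
    · exact le_add_of_nonneg_right (by positivity)
    · exact le_add_of_nonneg_left (by positivity)
  rcases hm.eq_or_lt with rfl | hm2
  · exact ⟨9 / 5, by norm_num, by norm_num, (hsum _ _ (.inl rfl)).trans (isBigO_mul_log_pow 3)⟩
  · have hm' : (2 : ℝ) ≤ m := by exact_mod_cast hm2
    have hpos : 0 < 1 / ((m : ℝ) + 1) := by positivity
    exact ⟨2 * m - 1 + 1 / (m + 1), by linarith, by linarith,
      (hsum _ _ (.inr rfl)).trans (isBigO_mul_log_pow 3)⟩

theorem theorem2 (m : ℕ) (hm : 1 ≤ m) :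
    (∃! f : ArithmeticFunction ℝ, HasMomentFactorSeries m f) ∧
    ∀ f : ArithmeticFunction ℝ, HasMomentFactorSeries m f →
      (fun k : ℕ =>
          (∑ h ∈ (Finset.Icc 1 k).filter (fun h : ℕ => Nat.Coprime h k),
              dedekindSum (h : ℤ) k ^ (2 * m)) -
            f k * ((k : ℝ) / 12) ^ (2 * m))
        =O[Filter.atTop]
      (fun k : ℕ =>
          ((k : ℝ) ^ (9 / 5 : ℝ) + (k : ℝ) ^ (2 * (m : ℝ) - 1 + 1 / ((m : ℝ) + 1))) *
            Real.log (k : ℝ) ^ 3) := by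
  obtain ⟨e, he, he', herror⟩ := exists_rpow_isBigO hm
  have hmoment := theorem2_general (σ := 2 * m) (by exact_mod_cast (by lia : 1 < 2 * m))
  simp only [rpow_two_mul_natCast, (even_two_mul m).pow_abs, ← hasMomentFactorSeries_iff] at hmoment
  exact hmoment.imp_right fun herror' f hf => (herror' f hf e he he').trans herror
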